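/- For integers $n\ge 0$ let $$\hat G_n(x,z)=\sum_{j=0}^{\lfloor n/2\rfloor}(-1)^j\,\frac{\prod_{i=n-\lfloor n/2\rfloor}^{n-j-1}(z+i)\;\prod_{i=\lfloor n/2\rfloor}^{n-1}\left(z+\tfrac12+i\right)}{j!\,(n-2j)!\;2^{2j}}\;x^{n-2j}$$ be the modified Gegenbauer polynomial, i.e. the Jacobi polynomial $P_n^{(z-1/2,\,z-1/2)}(x)$, regarded as a polynomial in $x$ and $z$. For integers $0\le k\le n$ put $m_{n,k}=\lfloor n/2\rfloor$ if $k\le n-\lfloor n/2\rfloor$ and $m_{n,k}=n-k$ if $k>n-\lfloor n/2\rfloor$. Two decreasing lists of real numbers $p_1,\dots,p_m$ and $q_1,\dots,q_{m'}$ with $m'\in\{m,m-1\}$ are said to interlace strictly if $p_1>q_1>p_2>q_2>\cdots$ (all entries of both lists being used), or, in case $m'=m$, if the same holds with the roles of $p$ and $q$ exchanged. Theorem. Let $z>-1/2$ and $0\le k\le n$. Then: (1) $\partial_z^k\hat G_n(x,z)$, as a polynomial in $x$, has degree exactly $n$ and all of its roots are real. (2) It has exactly $m_{n,k}$ positive roots,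 which are simple, and its negative roots are the opposites of its positive roots. If $n-\lfloor n/2\rfloor\le k<n$, then the multiplicity of the root $x=0$ in $\partial_z^{k+1}\hat G_n(x,z)$ is larger by exactly two than its multiplicity in $\partial_z^{k}\hat G_n(x,z)$. (3) For $1\le i\le m_{n,k}$, the $i$-th largest positive root is differentiable with negative derivative, hence strictly decreasing, as a function of $z\in(-1/2,\infty)$, and the $i$-th largest negative root is differentiable with positive derivative, hence strictly increasing. (4) If $k+1\le n$, the positive roots of $\partial_z^{k+1}\hat G_n(x,z)$ and those of $\partial_z^{k}\hat G_n(x,z)$ interlace strictly, and the same holds for their negative roots. -/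

import Mathlib

open Polynomial

noncomputable section

/-! Bivariate polynomials in `x` and `z` are elements of `ℝ[X][X] = (ℝ[x])[z]`: the inner variable
`C X` is `x`, the outer variable `X` is `z`. So `derivative` is the partial derivative in `z`, and
`eval (C z)` specializes the parameter and leaves a polynomial in `x`. -/

/-- The Gegenbauer polynomial
`G_n(x,z) = ∑_{j ≤ n/2} (-1)^j (∏_{i=0}^{n-j-1} (z+i)) / (j! (n-2j)!) (2x)^{n-2j}`. -/
def gegenbauer (n : ℕ) : ℝ[X][X] :=
  ∑ j ∈ Finset.range (n / 2 + 1),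
    C (C ((-1 : ℝ) ^ j / ((j.factorial : ℝ) * ((n - 2 * j).factorial : ℝ))) *
        (2 * X) ^ (n - 2 * j)) *
      ∏ i ∈ Finset.range (n - j), (X + C (C (i : ℝ)))

/-- The modified Gegenbauer polynomial
`Ĝ_n(x,z) = ∑_{j ≤ n/2} (-1)^j (∏_{i=n-⌊n/2⌋}^{n-j-1} (z+i)) (∏_{i=⌊n/2⌋}^{n-1} (z+1/2+i))
  / (j! (n-2j)!) x^{n-2j} 2^{-2j}`,
which is the Jacobi polynomial with both parameters equal to `z - 1/2`. -/
def gegenbauerHat (n : ℕ) : ℝ[X][X] :=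
  ∑ j ∈ Finset.range (n / 2 + 1),
    C (C ((-1 : ℝ) ^ j / ((j.factorial : ℝ) * ((n - 2 * j).factorial : ℝ) * 2 ^ (2 * j))) *
        X ^ (n - 2 * j)) *
      ((∏ i ∈ Finset.Ico (n - n / 2) (n - j), (X + C (C (i : ℝ)))) *
        ∏ i ∈ Finset.Ico (n / 2) n, (X + C (C (1 / 2 + (i : ℝ)))))

/-- The polynomial `x ↦ ∂_z^k Ĝ_n(x,z)`. -/
def gegenbauerHatDeriv (n k : ℕ) (z : ℝ) : ℝ[X] :=
  (derivative^[k] (gegenbauerHat n)).eval (C z)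

/-- `gegenbauerHatDeriv` is the analytic `k`-th partial derivative with respect to `z`. -/
theorem gegenbauerHatDeriv_eval (n k : ℕ) (z x : ℝ) :
    (gegenbauerHatDeriv n k z).eval x =
      iteratedDeriv k (fun w : ℝ => ((gegenbauerHat n).eval (C w)).eval x) z := by
  have key : ∀ (P : ℝ[X][X]) (w : ℝ),
      (P.eval (C w)).eval x = (P.map (evalRingHom x)).eval w := by
    intro P w
    have h := Polynomial.eval_map_apply (f := evalRingHom x) (p := P) (C w)
    simpa using h.symm
  have h1 : (fun w : ℝ => ((gegenbauerHat n).eval (C w)).eval x) =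
      fun w => ((gegenbauerHat n).map (evalRingHom x)).eval w := funext fun w => key _ w
  rw [h1, gegenbauerHatDeriv, key, ← Polynomial.iterate_derivative_map]
  generalize (gegenbauerHat n).map (evalRingHom x) = q
  induction k generalizing z with
  | zero => simp
  | succ k ih =>
    rw [iteratedDeriv_succ, ← funext ih, Polynomial.deriv, Function.iterate_succ_apply']

theorem prod_half_steps (n : ℕ) :
    ∏ i ∈ Finset.range n, (X + C (C ((i : ℝ) / 2)) : ℝ[X][X]) =
      (∏ i ∈ Finset.range (n - n / 2), (X + C (C (i : ℝ)))) *
        ∏ i ∈ Finset.range (n / 2), (X + C (C (1 / 2 + (i : ℝ)))) := by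
  induction n with
  | zero => simp
  | succ n ih =>
    rw [Finset.prod_range_succ, ih]
    rcases Nat.even_or_odd' n with ⟨m, rfl | rfl⟩
    · have h1 : 2 * m + 1 - (2 * m + 1) / 2 = m + 1 := by omega
      have h2 : (2 * m + 1) / 2 = m := by omega
      have h3 : 2 * m - 2 * m / 2 = m := by omega
      have h4 : 2 * m / 2 = m := by omega
      have h5 : ((2 * m : ℕ) : ℝ) / 2 = m := by push_cast; ring
      rw [h1, h2, h3, h4, h5, Finset.prod_range_succ]
      ring
    · have h1 : 2 * m + 1 + 1 - (2 * m + 1 + 1) / 2 = m + 1 := by omega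
      have h2 : (2 * m + 1 + 1) / 2 = m + 1 := by omega
      have h3 : 2 * m + 1 - (2 * m + 1) / 2 = m + 1 := by omega
      have h4 : (2 * m + 1) / 2 = m := by omega
      have h5 : ((2 * m + 1 : ℕ) : ℝ) / 2 = 1 / 2 + m := by push_cast; ring
      rw [h1, h2, h3, h4, h5, Finset.prod_range_succ (n := m)
        (f := fun i : ℕ => (X + C (C (1 / 2 + (i : ℝ))) : ℝ[X][X]))]
      ring

/-- The defining relation
`Ĝ_n(x,z) = (∏_{i<n} (z+1/2+i)) / (2^n ∏_{i<n} (z+i/2)) G_n(x,z)`, with denominators cleared. -/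
theorem gegenbauerHat_relation (n : ℕ) :
    C (C ((2 : ℝ) ^ n)) * (∏ i ∈ Finset.range n, (X + C (C ((i : ℝ) / 2)))) * gegenbauerHat n =
      (∏ i ∈ Finset.range n, (X + C (C (1 / 2 + (i : ℝ))))) * gegenbauer n := by
  rw [prod_half_steps, gegenbauerHat, gegenbauer, Finset.mul_sum, Finset.mul_sum]
  refine Finset.sum_congr rfl fun j hj => ?_
  have hj' : j ≤ n / 2 := by simpa [Nat.lt_succ_iff] using hj
  have e1 := Finset.prod_range_mul_prod_Ico
    (fun i : ℕ => (X + C (C (i : ℝ)) : ℝ[X][X])) (show n - n / 2 ≤ n - j by omega)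
  have e2 := Finset.prod_range_mul_prod_Ico
    (fun i : ℕ => (X + C (C (1 / 2 + (i : ℝ))) : ℝ[X][X])) (show n / 2 ≤ n by omega)
  rw [← e1, ← e2]
  have hc : (C (C ((2 : ℝ) ^ n)) : ℝ[X][X]) *
      C (C ((-1 : ℝ) ^ j / ((j.factorial : ℝ) * ((n - 2 * j).factorial : ℝ) * 2 ^ (2 * j))) *
        X ^ (n - 2 * j)) =
      C (C ((-1 : ℝ) ^ j / ((j.factorial : ℝ) * ((n - 2 * j).factorial : ℝ))) *
        (2 * X) ^ (n - 2 * j)) := by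
    have h2 : (2 : ℝ[X]) = C 2 := rfl
    rw [← C_mul, ← mul_assoc, ← C_mul, mul_pow, h2, ← C_pow, ← mul_assoc, ← C_mul]
    congr 3
    have hn : (2 : ℝ) ^ n = 2 ^ (n - 2 * j) * 2 ^ (2 * j) := by
      rw [← pow_add]; congr 1; omega
    rw [hn]
    have : (j.factorial : ℝ) ≠ 0 := by positivity
    have : ((n - 2 * j).factorial : ℝ) ≠ 0 := by positivity
    field_simp
  rw [← hc]
  ring

/-- The positive roots of `p`, with multiplicity, in decreasing order. -/
def posRoots (p : ℝ[X]) : List ℝ :=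
  (p.roots.filter (fun r => 0 < r)).sort (fun a b => b ≤ a)

/-- The negative roots of `p`, with multiplicity, in decreasing order. -/
def negRoots (p : ℝ[X]) : List ℝ :=
  (p.roots.filter (fun r => r < 0)).sort (fun a b => b ≤ a)

/-- `p₁ > q₁ > p₂ > q₂ > ⋯`, where `q` has as many entries as `p` or one fewer. -/
def AlternatesFrom (p q : List ℝ) : Prop :=
  (q.length = p.length ∨ q.length + 1 = p.length) ∧
    (∀ i : ℕ, i < q.length → q.getD i 0 < p.getD i 0) ∧
    (∀ i : ℕ, i + 1 < p.length → p.getD (i + 1) 0 < q.getD i 0)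

/-- Strict interlacing of two decreasing lists of roots: `p₁ > q₁ > p₂ > q₂ > ⋯`, or the same with
the roles of `p` and `q` permuted in case the two lists have the same length. -/
def StrictlyInterlace (p q : List ℝ) : Prop :=
  AlternatesFrom p q ∨ (q.length = p.length ∧ AlternatesFrom q p)

/-- `⌊n/2⌋` for `k ≤ n - ⌊n/2⌋`, and `n - k` for larger `k`. -/
def posRootCount (n k : ℕ) : ℕ :=
  if k ≤ n - n / 2 then n / 2 else n - k

end

noncomputable section

/-! Write m = ⌊n/2⌋, e = n mod 2, F_k = ∂_z^k Ĝ_n. Everything rests on one sign statement,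
`gegenbauerHatDeriv_transversal`: at a zero x ∈ (0,1) of F_k(·,z) with z > -1/2, the numbers ∂_x F_k
and ∂_z F_k = F_{k+1} are nonzero and have the same sign.

This is proved by fixing x and letting z vary. By `gegenbauerHatAt_eq`, Ĝ_n is a constant times x^e,
a product of linear factors in z, and ₂F₁(-m, z+n-m; 1/2+e; x²). In its second parameter the
hypergeometric sum is a Meixner polynomial, so for 0 < x < 1 the polynomial z ↦ Ĝ_n(x,z) has n
distinct real zeros (`card_roots_gegenbauerHatAt`). At each of them ∂_x and ∂_z do not have opposite
signs, by a Christoffel–Darboux type identity (`hyperB_wronskian`, `hyper_derivative_mul_pos`).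
Markov's principle (`markov_derivative`, `markov_iterate`) carries this sign property to all
z-derivatives.

Now fix z and let x vary. The signs of ∂_x F_k alternate along its simple positive zeros, hence so
do those of F_{k+1}, which therefore has a zero between any two neighbours. The sign of F_{k+1} near
0+ gives one more zero when it is needed (`IsRootSeq.exists_succ`). The new zeros lie below the old
ones, hence stay in (0,1), and the induction on k continues. Positivity of the coefficients
(`gegenbauerHatDeriv_shape`) gives the degree and the power of x dividing F_k, so symmetry accounts
for all zeros. Finally, implicit differentiation gives the zeros the velocity -F_{k+1}/∂_x F_k < 0.
-/

/-! ### Sign changes and interlacing zeros. -/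

theorem exists_root_Ioo_of_mul_neg (q : ℝ[X]) {x y : ℝ} (hxy : x < y)
    (h : q.eval x * q.eval y < 0) : ∃ s, x < s ∧ s < y ∧ q.eval s = 0 := by
  have hc : ContinuousOn (fun t => q.eval t) (Set.Icc x y) := q.continuous.continuousOn
  rcases mul_neg_iff.1 h with ⟨h1, h2⟩ | ⟨h1, h2⟩
  · obtain ⟨s, hs, hs'⟩ := intermediate_value_Ioo' hxy.le hc (show (0 : ℝ) ∈ _ from ⟨h2, h1⟩)
    exact ⟨s, hs.1, hs.2, hs'⟩
  · obtain ⟨s, hs, hs'⟩ := intermediate_value_Ioo hxy.le hc (show (0 : ℝ) ∈ _ from ⟨h1, h2⟩)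
    exact ⟨s, hs.1, hs.2, hs'⟩

theorem mul_neg_of_alternating {u v : ℝ} {i : ℕ} (hu : 0 < (-1) ^ i * u)
    (hv : 0 < (-1) ^ (i + 1) * v) : u * v < 0 := by
  rcases neg_one_pow_eq_or ℝ i with h | h <;> rw [pow_succ, h] at hv <;> rw [h] at hu <;> nlinarith

theorem prod_erase_sign {d i : ℕ} (hi : i < d) {u : ℕ → ℝ} (h1 : ∀ j, j < i → u j < 0)
    (h2 : ∀ j, i < j → j < d → 0 < u j) :
    0 < (-1) ^ i * ∏ j ∈ (Finset.range d).erase i, u j := by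
  have hs : (Finset.range d).erase i = Finset.range i ∪ Finset.Ioo i d := by
    ext j; simp only [Finset.mem_erase, Finset.mem_range, Finset.mem_union, Finset.mem_Ioo]; omega
  have hd : Disjoint (Finset.range i) (Finset.Ioo i d) := by
    rw [Finset.disjoint_left]; intro j hj
    simp only [Finset.mem_range, Finset.mem_Ioo] at *; omega
  rw [hs, Finset.prod_union hd, ← mul_assoc]
  refine mul_pos ?_ (Finset.prod_pos fun j hj => ?_)
  · have : (-1 : ℝ) ^ i = ∏ _j ∈ Finset.range i, (-1 : ℝ) := by simp
    rw [this, ← Finset.prod_mul_distrib]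
    refine Finset.prod_pos fun j hj => ?_
    have := h1 j (Finset.mem_range.1 hj); linarith
  · rw [Finset.mem_Ioo] at hj; exact h2 j hj.1 hj.2

theorem eval_derivative_prod_mul (r : ℕ → ℝ) (G : ℝ[X]) {d i : ℕ} (hi : i < d) :
    (derivative ((∏ j ∈ Finset.range d, (X - C (r j))) * G)).eval (r i) =
      (∏ j ∈ (Finset.range d).erase i, (r i - r j)) * G.eval (r i) := by
  rw [← Finset.mul_prod_erase _ _ (Finset.mem_range.2 hi)]
  simp [eval_prod]

theorem eq_C_mul_prod_of_roots {p : ℝ[X]} {m : ℕ} (hp : p.natDegree ≤ m)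
    (r : ℕ → ℝ) (hr : ∀ i j, i < j → j < m → r i ≠ r j)
    (hroot : ∀ i < m, p.eval (r i) = 0) :
    p = (∏ j ∈ Finset.range m, (X - C (r j))) * C p.leadingCoeff := by
  have hinj : Set.InjOn r (Finset.range m : Set ℕ) := by
    intro i hi j hj hij
    simp only [Finset.coe_range, Set.mem_Iio] at hi hj
    rcases lt_trichotomy i j with h | h | h
    · exact absurd hij (hr i j h hj)
    · exact h
    · exact absurd hij.symm (hr j i h hi)
  have hdvd : (∏ j ∈ Finset.range m, (X - C (r j))) ∣ p := by
    refine Finset.prod_dvd_of_coprime ?_ ?_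
    · intro i hi j hj hij
      exact isCoprime_X_sub_C_of_isUnit_sub
        (sub_ne_zero.2 fun h => hij (hinj hi hj h)).isUnit
    · intro i hi
      exact dvd_iff_isRoot.2 (hroot i (Finset.mem_range.1 hi))
  have hm : (∏ j ∈ Finset.range m, (X - C (r j))).Monic := monic_prod_of_monic _ _ fun j _ =>
    monic_X_sub_C _
  have hd : (∏ j ∈ Finset.range m, (X - C (r j))).natDegree = m := by
    rw [natDegree_prod_of_monic _ _ fun j _ => monic_X_sub_C _]; simp
  have := eq_leadingCoeff_mul_of_monic_of_dvd_of_natDegree_le hm hdvd (by omega)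
  rw [mul_comm]; exact this

/-- If `q` has the sign of `p'` at the `m` roots of `p`, and `p`, `q` have suitable signs at the
end points, then `q` has `m + 1` roots. -/
theorem exists_interlacing_roots {p q : ℝ[X]} {a B : ℝ} {m : ℕ} (haB : a < B) (r : ℕ → ℝ)
    (hr : ∀ i j, i < j → j < m → r i < r j) (hmem : ∀ i < m, a < r i ∧ r i < B)
    (hroot : ∀ i < m, p.eval (r i) = 0) (hp : p.natDegree ≤ m)
    (hpa : 0 < p.eval a) (hqa : 0 < q.eval a) (hqB : 0 < (-1) ^ (m + 1) * q.eval B)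
    (hW : ∀ i < m, (derivative p).eval (r i) ≠ 0 → 0 < (derivative p).eval (r i) * q.eval (r i)) :
    ∃ s : ℕ → ℝ, (∀ i j, i < j → j < m + 1 → s i < s j) ∧
      ∀ i < m + 1, a < s i ∧ s i < B ∧ q.eval (s i) = 0 := by
  have hpG := eq_C_mul_prod_of_roots hp r (fun i j h1 h2 => (hr i j h1 h2).ne) hroot
  set g := p.leadingCoeff
  -- All m roots lie to the right of `a`, so positivity at `a` fixes the sign of the leading
  -- coefficient.
  have hsg : 0 < (-1) ^ m * g := by
    rw [hpG, eval_mul, eval_C, eval_prod] at hpa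
    have h1 : ∏ j ∈ Finset.range m, (X - C (r j)).eval a =
        (-1) ^ m * ∏ j ∈ Finset.range m, (r j - a) := by
      have : (-1 : ℝ) ^ m = ∏ _j ∈ Finset.range m, (-1 : ℝ) := by simp
      rw [this, ← Finset.prod_mul_distrib]
      exact Finset.prod_congr rfl fun j _ => by simp
    have h2 : 0 < ∏ j ∈ Finset.range m, (r j - a) :=
      Finset.prod_pos fun j hj => sub_pos.2 (hmem j (Finset.mem_range.1 hj)).1
    rw [h1] at hpa
    have : 0 < ((-1) ^ m * g) * ∏ j ∈ Finset.range m, (r j - a) := by linarith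
    exact pos_of_mul_pos_left this h2.le
  have hq : ∀ i < m, 0 < (-1) ^ (i + 1) * q.eval (r i) := by
    intro i hi
    have hd : (derivative p).eval (r i) = -((-1) ^ m * g) *
        ∏ j ∈ (Finset.range m).erase i, (r j - r i) := by
      rw [hpG, eval_derivative_prod_mul r _ hi]
      have h1 : ∏ j ∈ (Finset.range m).erase i, (r i - r j) =
          (-1) ^ (m - 1) * ∏ j ∈ (Finset.range m).erase i, (r j - r i) := by
        have : (-1 : ℝ) ^ (m - 1) = ∏ _j ∈ (Finset.range m).erase i, (-1 : ℝ) := by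
          simp [Finset.card_erase_of_mem (Finset.mem_range.2 hi)]
        rw [this, ← Finset.prod_mul_distrib]
        exact Finset.prod_congr rfl fun j _ => by ring
      obtain ⟨m', rfl⟩ : ∃ m', m = m' + 1 := ⟨m - 1, by omega⟩
      rw [h1, eval_C, Nat.add_sub_cancel, pow_succ]; ring
    have hs := prod_erase_sign hi (u := fun j => r j - r i)
      (fun j hj => sub_neg.2 (hr j i hj hi)) (fun j h1 h2 => sub_pos.2 (hr i j h1 h2))
    have hs' : 0 < (-1) ^ (i + 1) * (derivative p).eval (r i) := by
      have := mul_pos hsg hs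
      rw [hd, pow_succ]; linarith
    have h3 := hW i hi (by rintro h; simp [h] at hs')
    have h4 : 0 < ((-1) ^ (i + 1) * q.eval (r i)) * ((-1) ^ (i + 1) * (derivative p).eval (r i)) := by
      have : ((-1 : ℝ) ^ (i + 1)) * (-1) ^ (i + 1) = 1 := by
        rw [← mul_pow]; simp
      have e : ((-1) ^ (i + 1) * q.eval (r i)) * ((-1) ^ (i + 1) * (derivative p).eval (r i)) =
        (((-1 : ℝ) ^ (i + 1)) * (-1) ^ (i + 1)) * ((derivative p).eval (r i) * q.eval (r i)) := by ring
      rw [e, this, one_mul]; exact h3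
    exact pos_of_mul_pos_left h4 hs'.le
  -- The m + 2 nodes a, r 0, …, r (m-1), B; at the k-th node `q` has sign (-1)^k.
  let P : ℕ → ℝ := fun k => if k = 0 then a else if k ≤ m then r (k - 1) else B
  have hP : ∀ k < m + 1, P k < P (k + 1) := by
    intro k hk
    simp only [P]
    rcases Nat.eq_zero_or_pos k with rfl | h0
    · by_cases hm : 1 ≤ m
      · simp [hm, (hmem 0 hm).1]
      · simp [hm, haB]
    · have hk' : k ≤ m := by omega
      by_cases hm : k + 1 ≤ m
      · simp [h0.ne', hk', hm]; exact hr _ _ (by omega) (by omega)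
      · simp [h0.ne', hk', hm]; exact (hmem _ (by omega)).2
  have hPs : ∀ k ≤ m + 1, 0 < (-1) ^ k * q.eval (P k) := by
    intro k hk
    simp only [P]
    rcases Nat.eq_zero_or_pos k with rfl | h0
    · simpa using hqa
    · by_cases hm : k ≤ m
      · have := hq (k - 1) (by omega)
        rw [Nat.sub_add_cancel h0] at this
        simpa [h0.ne', hm] using this
      · obtain rfl : k = m + 1 := by omega
        simpa using hqB
  -- Stated for all k, with a dummy value 0 out of range, so that `choose` yields a function on ℕ.
  have hex : ∀ k, ∃ s, k < m + 1 → P k < s ∧ s < P (k + 1) ∧ q.eval s = 0 := by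
    intro k
    by_cases hk : k < m + 1
    · obtain ⟨s, hs⟩ := exists_root_Ioo_of_mul_neg q (hP k hk)
        (mul_neg_of_alternating (hPs k hk.le) (hPs (k + 1) hk))
      exact ⟨s, fun _ => hs⟩
    · exact ⟨0, fun h => absurd h hk⟩
  choose s hs using hex
  have hPmono : ∀ j, ∀ i ≤ j, j ≤ m + 1 → P i ≤ P j := by
    intro j
    induction j with
    | zero => intro i hi _; rw [Nat.le_zero.1 hi]
    | succ j ih =>
      intro i hi hj
      rcases Nat.lt_or_ge i (j + 1) with h | h
      · exact (ih i (by omega) (by omega)).trans (hP j (by omega)).le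
      · rw [show i = j + 1 by omega]
  refine ⟨s, fun i j hij hj => ?_, fun i hi => ⟨?_, ?_, (hs i hi).2.2⟩⟩
  · exact (hs i (by omega)).2.1.trans_le ((hPmono j (i + 1) hij hj.le).trans (hs j hj).1.le)
  · have := hPmono i 0 (Nat.zero_le _) hi.le
    exact lt_of_le_of_lt (by simpa [P] using this) (hs i hi).1
  · have := hPmono (m + 1) (i + 1) (by omega) le_rfl
    exact lt_of_lt_of_le (hs i hi).2.1 (by simpa [P] using this)

/-! ### Recurrences and zeros of ₂F₁(-m, b; c; t), in t and in b. -/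

/-- The terminating hypergeometric sum `₂F₁(-m, b; c; t)` as a polynomial in `t`. -/
def hyperT (m : ℕ) (c b : ℝ) : ℝ[X] :=
  ∑ l ∈ Finset.range (m + 1),
    C ((-1) ^ l * (m.choose l : ℝ) * ((ascPochhammer ℝ l).eval b / (ascPochhammer ℝ l).eval c)) *
      X ^ l

/-- The terminating hypergeometric sum `₂F₁(-m, b; c; t)` (a Meixner polynomial) as a polynomial
in `b`. -/
def hyperB (m : ℕ) (c t : ℝ) : ℝ[X] :=
  ∑ l ∈ Finset.range (m + 1),
    C ((-1) ^ l * (m.choose l : ℝ) * t ^ l / (ascPochhammer ℝ l).eval c) * ascPochhammer ℝ l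

theorem eval_hyperB (m : ℕ) (c b t : ℝ) : (hyperB m c t).eval b = (hyperT m c b).eval t := by
  simp only [hyperB, hyperT, eval_finsetSum, eval_mul, eval_C, eval_pow, eval_X]
  exact Finset.sum_congr rfl fun l _ => by ring

theorem hyperT_coeff (m : ℕ) (c b : ℝ) (l : ℕ) : (hyperT m c b).coeff l =
    (-1) ^ l * (m.choose l : ℝ) * ((ascPochhammer ℝ l).eval b / (ascPochhammer ℝ l).eval c) := by
  simp only [hyperT, finsetSum_coeff, coeff_C_mul, coeff_X_pow, mul_ite, mul_one, mul_zero,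
    Finset.sum_ite_eq, Finset.mem_range]
  split_ifs with h
  · rfl
  · rw [Nat.choose_eq_zero_of_lt (by omega)]; simp

theorem hyperT_natDegree_le (m : ℕ) (c b : ℝ) : (hyperT m c b).natDegree ≤ m := by
  rw [natDegree_le_iff_coeff_eq_zero]
  intro l hl
  rw [hyperT_coeff, Nat.choose_eq_zero_of_lt (by exact_mod_cast hl)]; simp

theorem coeff_X_mul_derivative (p : ℝ[X]) (l : ℕ) :
    (X * derivative p).coeff l = l * p.coeff l := by
  cases l with
  | zero => simp
  | succ l => rw [coeff_X_mul, coeff_derivative]; push_cast; ring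

theorem ascPochhammer_eval_pos {c : ℝ} (hc : 0 < c) (l : ℕ) : 0 < (ascPochhammer ℝ l).eval c :=
  ascPochhammer_pos l c hc

/-- Coefficientwise this is l·C(m+1,l) = (m+1)(C(m+1,l) - C(m,l)). It trades the t-derivative for a
lower index, which lets a Wronskian in b control derivatives in t. -/
theorem hyperT_X_mul_derivative (m : ℕ) (c b : ℝ) :
    X * derivative (hyperT (m + 1) c b) =
      C ((m : ℝ) + 1) * (hyperT (m + 1) c b - hyperT m c b) := by
  ext l
  rw [coeff_X_mul_derivative, coeff_C_mul, coeff_sub, hyperT_coeff, hyperT_coeff]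
  have h : (l : ℝ) * ((m + 1).choose l : ℝ) =
      (m + 1) * (((m + 1).choose l : ℝ) - (m.choose l : ℝ)) := by
    cases l with
    | zero => simp
    | succ l =>
      have h1 := Nat.add_one_mul_choose_eq m l
      have h2 := Nat.choose_succ_succ m l
      have h1' : ((m : ℝ) + 1) * (m.choose l : ℝ) = ((m + 1).choose (l + 1) : ℝ) * (l + 1) := by
        exact_mod_cast h1
      have h2' : ((m + 1).choose (l + 1) : ℝ) = m.choose l + m.choose (l + 1) := by
        exact_mod_cast h2
      push_cast
      linear_combination -h1' - ((m : ℝ) + 1) * h2'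
  linear_combination (-1) ^ l * ((ascPochhammer ℝ l).eval b / (ascPochhammer ℝ l).eval c) * h

/-- A raising relation with two uses: at a zero of the m-th sum only the t-derivative term survives,
and at t = 1 that term disappears. -/
theorem hyperT_succ (m : ℕ) {c : ℝ} (hc : 0 < c) (b : ℝ) :
    C (c + m) * hyperT (m + 1) c b =
      (C (m + c) - C b * X) * hyperT m c b + (1 - X) * (X * derivative (hyperT m c b)) := by
  ext l
  rw [sub_mul, sub_mul, one_mul, mul_assoc]
  simp only [coeff_add, coeff_sub, coeff_C_mul]
  cases l with
  | zero => simp [hyperT_coeff]; ring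
  | succ l =>
    rw [coeff_X_mul_derivative _ (l + 1), coeff_X_mul, coeff_X_mul, coeff_X_mul_derivative]
    simp only [hyperT_coeff, ascPochhammer_succ_eval]
    have h0 := (ascPochhammer_eval_pos hc l).ne'
    have h1 : c + l ≠ 0 := by positivity
    have h3 : (m.choose (l + 1) : ℝ) * (l + 1) = m.choose l * (m - l) := by
      rcases le_or_gt l m with h | h
      · have := Nat.choose_succ_right_eq m l
        rw [← Nat.cast_sub h]; exact_mod_cast this
      · rw [Nat.choose_eq_zero_of_lt h, Nat.choose_eq_zero_of_lt (by omega : m < l + 1)]; simp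
    have h2' : ((m + 1).choose (l + 1) : ℝ) = m.choose l + m.choose (l + 1) := by
      exact_mod_cast Nat.choose_succ_succ m l
    rw [h2', pow_succ]
    push_cast
    field_simp
    linear_combination ((b + l) * (ascPochhammer ℝ l).eval b) * h3

/-- The derivative is eliminated between the two preceding relations. The coefficients are affine in
b, so this is also a recurrence of orthogonal polynomial type in b. -/
theorem hyperT_three_term (m : ℕ) {c : ℝ} (hc : 0 < c) (b t : ℝ) :
    (c + m + 1) * (hyperT (m + 2) c b).eval t =
      (2 * (m + 1) + c - (m + 1 + b) * t) * (hyperT (m + 1) c b).eval t -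
        (m + 1) * (1 - t) * (hyperT m c b).eval t := by
  have h1 := congrArg (eval t) (hyperT_succ (m + 1) hc b)
  have h2 := congrArg (eval t) (hyperT_X_mul_derivative m c b)
  rw [eval_add, eval_mul (p := 1 - X), h2] at h1
  simp at h1
  linear_combination h1

theorem hyperT_eval_zero (m : ℕ) (c b : ℝ) : (hyperT m c b).eval 0 = 1 := by
  rw [← coeff_zero_eq_eval_zero, hyperT_coeff]; simp

theorem hyperT_zero (c b : ℝ) : hyperT 0 c b = 1 := by simp [hyperT]

theorem hyperB_zero (c t : ℝ) : hyperB 0 c t = 1 := by simp [hyperB]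

theorem hyperB_three_term (m : ℕ) {c : ℝ} (hc : 0 < c) (t : ℝ) :
    C (c + m + 1) * hyperB (m + 2) c t =
      (C (2 * (m + 1) + c - (m + 1) * t) - C t * X) * hyperB (m + 1) c t -
        C ((m + 1) * (1 - t)) * hyperB m c t := by
  refine Polynomial.funext fun b => ?_
  simp only [eval_mul, eval_sub, eval_C, eval_X, eval_hyperB]
  rw [hyperT_three_term m hc]; ring

/-- Christoffel–Darboux: with B_m the m-th polynomial and W_m this Wronskian, the three-term
recurrence gives (c+m+1) W_{m+1} = t B_{m+1}² + (m+1)(1-t) W_m, and every weight is positive for 0 <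
t < 1. -/
theorem hyperB_wronskian (m : ℕ) {c t : ℝ} (hc : 0 < c) (ht : 0 < t) (ht1 : t < 1) (b : ℝ) :
    0 < (derivative (hyperB m c t)).eval b * (hyperB (m + 1) c t).eval b -
      (hyperB m c t).eval b * (derivative (hyperB (m + 1) c t)).eval b := by
  induction m with
  | zero =>
    simp only [hyperB, Finset.sum_range_succ, Finset.sum_range_zero]
    simp
    exact div_neg_of_neg_of_pos (neg_neg_of_pos ht) hc
  | succ m ih =>
    have h := hyperB_three_term m hc t
    have h1 := congrArg (eval b) h
    have h2 := congrArg (eval b) (congrArg derivative h)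
    simp only [derivative_mul, derivative_sub, derivative_C, derivative_X, eval_add, eval_sub, eval_neg,
      eval_mul, eval_C, eval_X, zero_mul, zero_add, zero_sub, mul_one] at h1 h2
    have hcm : 0 < c + m + 1 := by positivity
    refine pos_of_mul_pos_right (a := c + m + 1) ?_ hcm.le
    have e : (c + m + 1) * ((derivative (hyperB (m + 1) c t)).eval b *
        (hyperB (m + 2) c t).eval b -
        (hyperB (m + 1) c t).eval b * (derivative (hyperB (m + 2) c t)).eval b) =
        t * ((hyperB (m + 1) c t).eval b) ^ 2 + (m + 1) * (1 - t) *
        ((derivative (hyperB m c t)).eval b * (hyperB (m + 1) c t).eval b -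
          (hyperB m c t).eval b * (derivative (hyperB (m + 1) c t)).eval b) := by
      linear_combination (derivative (hyperB (m + 1) c t)).eval b * h1 -
        (hyperB (m + 1) c t).eval b * h2
    rw [e]
    have : 0 < (m + 1) * (1 - t) := mul_pos (by positivity) (by linarith)
    have := mul_pos this ih
    positivity

theorem hyperB_natDegree_le (m : ℕ) (c t : ℝ) : (hyperB m c t).natDegree ≤ m := by
  refine natDegree_sum_le_of_forall_le _ _ fun l hl => ?_
  refine (natDegree_C_mul_le _ _).trans ?_
  rw [ascPochhammer_natDegree]
  have := Finset.mem_range.1 hl; omega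

theorem hyperB_coeff_self (m : ℕ) (c t : ℝ) :
    (hyperB m c t).coeff m = (-1) ^ m * t ^ m / (ascPochhammer ℝ m).eval c := by
  rw [hyperB, Finset.sum_range_succ, coeff_add, coeff_C_mul, finsetSum_coeff,
    Finset.sum_eq_zero]
  · have : (ascPochhammer ℝ m).coeff m = 1 := by
      have h := (monic_ascPochhammer ℝ m).coeff_natDegree
      rwa [ascPochhammer_natDegree] at h
    rw [this]; simp
  · intro l hl
    rw [coeff_C_mul, coeff_eq_zero_of_natDegree_lt, mul_zero]
    rw [ascPochhammer_natDegree]; exact Finset.mem_range.1 hl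

/-- At b = c the Pochhammer symbols cancel and the binomial theorem leaves (1-t)^m. This makes c the
left end point of the interlacing induction in b. -/
theorem hyperB_eval_self_pos (m : ℕ) {c t : ℝ} (hc : 0 < c) (ht1 : t < 1) :
    0 < (hyperB m c t).eval c := by
  have : (hyperB m c t).eval c = (1 - t) ^ m := by
    rw [sub_eq_neg_add, add_pow, hyperB, eval_finsetSum]
    refine Finset.sum_congr rfl fun l _ => ?_
    rw [eval_mul, eval_C, div_mul_cancel₀ _ (ascPochhammer_eval_pos hc l).ne', neg_pow]
    simp; ring
  rw [this]
  exact pow_pos (by linarith) m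

theorem hyperB_eventually_sign (m : ℕ) {c t : ℝ} (hc : 0 < c) (ht : 0 < t) :
    ∀ᶠ b in Filter.atTop, 0 < (-1) ^ m * (hyperB m c t).eval b := by
  have hco : (C ((-1) ^ m) * hyperB m c t).coeff m = t ^ m / (ascPochhammer ℝ m).eval c := by
    have h1 : ((-1 : ℝ) ^ m) * (-1) ^ m = 1 := by rw [← mul_pow]; simp
    rw [coeff_C_mul, hyperB_coeff_self, mul_div_assoc, ← mul_assoc, h1, one_mul]
  have hpos : 0 < (C ((-1) ^ m) * hyperB m c t).coeff m := by
    rw [hco]; exact div_pos (pow_pos ht m) (ascPochhammer_eval_pos hc m)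
  have hdeg : (C ((-1) ^ m) * hyperB m c t).natDegree = m :=
    le_antisymm ((natDegree_C_mul_le _ _).trans (hyperB_natDegree_le m c t))
      (le_natDegree_of_ne_zero hpos.ne')
  rcases Nat.eq_zero_or_pos m with rfl | hm
  · simp [hyperB_zero]
  · have := (C ((-1) ^ m) * hyperB m c t).tendsto_atTop_of_leadingCoeff_nonneg
      (by rw [← natDegree_pos_iff_degree_pos]; omega) (by rw [leadingCoeff, hdeg]; exact hpos.le)
    filter_upwards [this.eventually_gt_atTop 0] with b hb
    simpa using hb

/-- For `0 < t < 1`, all zeros of `b ↦ ₂F₁(-m, b; c; t)` are real, simple and larger than `c`. -/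
theorem hyperB_roots (m : ℕ) {c t : ℝ} (hc : 0 < c) (ht : 0 < t) (ht1 : t < 1) :
    ∃ r : ℕ → ℝ, (∀ i j, i < j → j < m → r i < r j) ∧
      ∀ i < m, c < r i ∧ (hyperB m c t).eval (r i) = 0 := by
  induction m with
  | zero => exact ⟨fun _ => 0, fun i j _ h => absurd h (by omega), fun i h => absurd h (by omega)⟩
  | succ m ih =>
    obtain ⟨r, hr, hroot⟩ := ih
    have hev : ∀ᶠ b in Filter.atTop, c < b ∧ (∀ i ∈ Finset.range m, r i < b) ∧
        0 < (-1) ^ (m + 1) * (hyperB (m + 1) c t).eval b := by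
      refine (Filter.eventually_gt_atTop c).and (Filter.Eventually.and ?_
        (hyperB_eventually_sign (m + 1) hc ht))
      rw [Filter.eventually_all_finset]
      exact fun i _ => Filter.eventually_gt_atTop (r i)
    obtain ⟨B, hB, hrB, hs⟩ := hev.exists
    -- At a zero of the m-th polynomial the Wronskian reduces to its derivative times the next
    -- polynomial, which is the required sign condition.
    obtain ⟨s, hs1, hs2⟩ := exists_interlacing_roots hB r hr
      (fun i hi => ⟨(hroot i hi).1, hrB i (Finset.mem_range.2 hi)⟩) (fun i hi => (hroot i hi).2)
      (hyperB_natDegree_le m c t) (hyperB_eval_self_pos m hc ht1)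
      (hyperB_eval_self_pos (m + 1) hc ht1) hs (fun i hi _ => by
        have := hyperB_wronskian m hc ht ht1 (r i)
        rw [(hroot i hi).2] at this
        linarith)
    exact ⟨s, hs1, fun i hi => ⟨(hs2 i hi).1, (hs2 i hi).2.2⟩⟩

/-- At t = 1 the raising relation reads (c+m) T_{m+1}(1) = (m+c-b) T_m(1), as in Chu–Vandermonde,
and the bound on b makes all factors m+c-b that occur negative. -/
theorem hyperT_eval_one_sign (m : ℕ) {c b : ℝ} (hc : 0 < c) (hb : c + m < b + 1) :
    0 < (-1) ^ m * (hyperT m c b).eval 1 := by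
  induction m with
  | zero => simp [hyperT_zero]
  | succ m ih =>
    push_cast at hb
    have h1 := congrArg (eval 1) (hyperT_succ m hc b)
    simp at h1
    have hcm : 0 < c + m := by positivity
    refine pos_of_mul_pos_right (a := c + m) ?_ hcm.le
    have := mul_pos (show 0 < b - (m + c) by linarith) (ih (by linarith))
    have e : (c + m) * ((-1) ^ (m + 1) * (hyperT (m + 1) c b).eval 1) =
        (b - (m + c)) * ((-1) ^ m * (hyperT m c b).eval 1) := by
      rw [pow_succ]; linear_combination -(-1) ^ m * h1
    rw [e]; exact this

/-- For `b > c + m - 1`, the polynomial `t ↦ ₂F₁(-m, b; c; t)` has `m` zeros in `(0,1)`. -/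
theorem hyperT_roots (m : ℕ) {c b : ℝ} (hc : 0 < c) (hb : c + m < b + 1) :
    ∃ r : ℕ → ℝ, (∀ i j, i < j → j < m → r i < r j) ∧
      ∀ i < m, 0 < r i ∧ r i < 1 ∧ (hyperT m c b).eval (r i) = 0 := by
  induction m with
  | zero => exact ⟨fun _ => 0, fun i j _ h => absurd h (by omega), fun i h => absurd h (by omega)⟩
  | succ m ih =>
    push_cast at hb
    obtain ⟨r, hr, hroot⟩ := ih (by linarith)
    -- At a zero t of T_m the raising relation is (c+m) T_{m+1} = t(1-t) T_m', so the signs agree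
    -- wherever T_m' is nonzero.
    exact exists_interlacing_roots one_pos r hr
      (fun i hi => ⟨(hroot i hi).1, (hroot i hi).2.1⟩) (fun i hi => (hroot i hi).2.2)
      (hyperT_natDegree_le m c b) (by simp [hyperT_eval_zero]) (by simp [hyperT_eval_zero])
      (hyperT_eval_one_sign (m + 1) hc (by push_cast; linarith)) (fun i hi hne => by
        obtain ⟨h0, h1, h2⟩ := hroot i hi
        have h := congrArg (eval (r i)) (hyperT_succ m hc b)
        simp [h2] at h
        have hcm : 0 < c + m := by positivity
        refine pos_of_mul_pos_right (a := c + m) ?_ hcm.le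
        have h3 : 0 < (1 - r i) * r i * ((derivative (hyperT m c b)).eval (r i)) ^ 2 := by
          have := mul_pos (show 0 < 1 - r i by linarith) h0
          positivity
        calc _ < _ := h3
          _ = _ := by linear_combination -(derivative (hyperT m c b)).eval (r i) * h)

/-- The zeros of `₂F₁(-m, b; c; t)` move monotonically: at a zero, the derivatives in `b` and in `t`
have the same sign. -/
theorem hyper_derivative_mul_pos (m : ℕ) {c b t : ℝ} (hc : 0 < c) (ht : 0 < t) (ht1 : t < 1)
    (h0 : (hyperT m c b).eval t = 0) :
    0 < (derivative (hyperT m c b)).eval t * (derivative (hyperB m c t)).eval b := by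
  cases m with
  | zero => simp [hyperT_zero] at h0
  | succ m =>
    -- At a zero of T_{m+1} the Wronskian is -T_m ∂_b T_{m+1}, while t ∂_t T_{m+1} = -(m+1) T_m.
    have hw := hyperB_wronskian m hc ht ht1 b
    have h := congrArg (eval t) (hyperT_X_mul_derivative m c b)
    simp only [eval_mul, eval_X, eval_C, eval_sub, h0, eval_hyperB] at h hw
    refine pos_of_mul_pos_right (a := t) ?_ ht.le
    have h2 := mul_pos (show (0 : ℝ) < m + 1 by positivity) hw
    calc _ < _ := h2
      _ = _ := by linear_combination -(derivative (hyperB (m + 1) c t)).eval b * h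

/-! ### Partial fractions and Markov's principle. -/

theorem eq_C_mul_prod_roots_toFinset {h : ℝ[X]} (hs : h.roots.toFinset.card = h.natDegree) :
    h = C h.leadingCoeff * ∏ v ∈ h.roots.toFinset, (X - C v) := by
  have h1 : h.roots.card = h.natDegree := le_antisymm (card_roots' h)
    (hs ▸ Multiset.toFinset_card_le h.roots)
  have h2 : h.roots.Nodup := Multiset.toFinset_card_eq_card_iff_nodup.1 (hs.trans h1.symm)
  have h3 := C_leadingCoeff_mul_prod_multiset_X_sub_C h1
  rw [Finset.prod, Multiset.toFinset_val, h2.dedup]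
  exact h3.symm

/-- The expansion g/h = c + Σ (g(v)/h'(v))/(X - v) over the simple zeros v of `h`, multiplied
through by `h`; `H v` is h/(X - v). -/
theorem partial_fractions {h g : ℝ[X]} (h0 : h ≠ 0)
    (hs : h.roots.toFinset.card = h.natDegree) (hg : g.natDegree ≤ h.natDegree) :
    ∃ (c : ℝ) (H : ℝ → ℝ[X]),
      (∀ v ∈ h.roots.toFinset, h = (X - C v) * H v ∧ (derivative h).eval v ≠ 0) ∧
      g = C c * h + ∑ v ∈ h.roots.toFinset,
        C (g.eval v / (derivative h).eval v) * H v := by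
  set S := h.roots.toFinset with hS
  set a := h.leadingCoeff with ha
  have ha0 : a ≠ 0 := leadingCoeff_ne_zero.2 h0
  have hfac := eq_C_mul_prod_roots_toFinset hs
  let H : ℝ → ℝ[X] := fun v => C a * ∏ u ∈ S.erase v, (X - C u)
  have hH : ∀ v ∈ S, h = (X - C v) * H v := by
    intro v hv
    simp only [H]
    conv_lhs => rw [hfac, ← Finset.mul_prod_erase _ _ hv]
    ring
  have hHv : ∀ v ∈ S, (derivative h).eval v = (H v).eval v := by
    intro v hv
    conv_lhs => rw [hH v hv]
    simp
  have hHne : ∀ v ∈ S, (H v).eval v ≠ 0 := by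
    intro v hv
    simp only [H, eval_mul, eval_C, eval_prod, eval_sub, eval_X]
    refine mul_ne_zero ha0 (Finset.prod_ne_zero_iff.2 fun u hu => sub_ne_zero.2 ?_)
    exact (Finset.ne_of_mem_erase hu).symm
  have hHuv : ∀ v ∈ S, ∀ u ∈ S, u ≠ v → (H v).eval u = 0 := by
    intro v hv u hu huv
    simp only [H, eval_mul, eval_prod]
    rw [Finset.prod_eq_zero (Finset.mem_erase.2 ⟨huv, hu⟩) (by simp), mul_zero]
  have hroot : ∀ v ∈ S, h.eval v = 0 := fun v hv => by
    rw [hS, Multiset.mem_toFinset, mem_roots h0] at hv; exact hv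
  refine ⟨g.coeff h.natDegree / a, H, fun v hv => ⟨hH v hv, by rw [hHv v hv]; exact hHne v hv⟩, ?_⟩
  -- With this c the coefficients of degree deg h cancel, so the difference of the two sides has
  -- degree below the number of zeros of `h`; it also vanishes at those zeros.
  refine eq_of_degree_sub_lt_of_eval_finset_eq S ?_ ?_
  · rw [hs, degree_lt_iff_coeff_zero]
    intro k hk
    have hsum : (∑ v ∈ S, C (g.eval v / (derivative h).eval v) * H v).coeff k = 0 := by
      rw [finsetSum_coeff]
      refine Finset.sum_eq_zero fun v hv => ?_
      rw [coeff_C_mul, coeff_eq_zero_of_natDegree_lt, mul_zero]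
      have h2 : (∏ u ∈ S.erase v, (X - C u)).natDegree = S.card - 1 := by
        rw [natDegree_prod_of_monic _ _ fun j _ => monic_X_sub_C _]
        simp [Finset.card_erase_of_mem hv]
      have h3 : 0 < S.card := Finset.card_pos.2 ⟨v, hv⟩
      have := (natDegree_C_mul_le a (∏ u ∈ S.erase v, (X - C u))).trans h2.le
      simp only [H]
      omega
    rw [coeff_sub, coeff_add, hsum, coeff_C_mul, add_zero]
    rcases hk.eq_or_lt with h | h
    · subst h
      have : h.coeff h.natDegree = a := rfl
      rw [this, div_mul_cancel₀ _ ha0, sub_self]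
    · rw [coeff_eq_zero_of_natDegree_lt (hg.trans_lt h), coeff_eq_zero_of_natDegree_lt h]; simp
  · intro u hu
    rw [eval_add, eval_mul, hroot u hu, mul_zero, zero_add, eval_finsetSum,
      Finset.sum_eq_single u, eval_mul, eval_C, hHv u hu, div_mul_cancel₀ _ (hHne u hu)]
    · intro v hv hvu
      rw [eval_mul, hHuv v hv u hu hvu.symm, mul_zero]
    · intro h; exact absurd hu h

/-- At a critical point of `h` one has (g/h)' = g'/h; differentiate the partial fraction expansion
there. -/
theorem eval_derivative_of_partial_fractions {h g : ℝ[X]} (h0 : h ≠ 0)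
    (hs : h.roots.toFinset.card = h.natDegree) (hg : g.natDegree ≤ h.natDegree) {w : ℝ}
    (hw : (derivative h).eval w = 0) :
    h.eval w ≠ 0 ∧ (derivative g).eval w = -h.eval w * ∑ v ∈ h.roots.toFinset,
      g.eval v / (derivative h).eval v / (w - v) ^ 2 := by
  obtain ⟨c, H, hH, hgeq⟩ := partial_fractions h0 hs hg
  have hne : h.eval w ≠ 0 := by
    intro h1
    have := (hH w (by rw [Multiset.mem_toFinset, mem_roots h0]; exact h1)).2
    exact this hw
  refine ⟨hne, ?_⟩
  conv_lhs => rw [hgeq]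
  rw [derivative_add, derivative_C_mul, eval_add, eval_mul, hw, mul_zero, zero_add,
    derivative_sum, eval_finsetSum, Finset.mul_sum]
  refine Finset.sum_congr rfl fun v hv => ?_
  obtain ⟨h1, h2⟩ := hH v hv
  have e1 := congrArg (eval w) h1
  have e2 := congrArg (eval w) (congrArg derivative h1)
  rw [hw] at e2
  simp at e1 e2
  have hwv : w - v ≠ 0 := by
    intro h3; rw [h3, zero_mul] at e1; exact hne e1
  rw [derivative_C_mul, eval_mul, eval_C]
  field_simp
  rw [e1]
  linear_combination -(w - v) * e2 * g.eval v

/-- Markov's principle: if all roots of `h` move monotonically (infinitesimally, along `g`), then so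
do the roots of `h'`. -/
theorem markov_derivative {h g : ℝ[X]} (h0 : h ≠ 0)
    (hs : h.roots.toFinset.card = h.natDegree) (hg : g.natDegree ≤ h.natDegree)
    (h1 : ∀ v, h.eval v = 0 → 0 ≤ g.eval v * (derivative h).eval v)
    (h2 : ∃ v, h.eval v = 0 ∧ 0 < g.eval v * (derivative h).eval v) {w : ℝ}
    (hw : (derivative h).eval w = 0) :
    0 < (derivative g).eval w * (derivative (derivative h)).eval w := by
  obtain ⟨hne, e1⟩ := eval_derivative_of_partial_fractions h0 hs hg hw
  -- With h' in the role of `g` all residues are 1. Thus g'(w) and h''(w) are both -h(w) times a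
  -- positive sum.
  obtain ⟨-, e2⟩ := eval_derivative_of_partial_fractions h0 hs
    (natDegree_derivative_le h |>.trans (Nat.sub_le _ _)) hw
  have hmem : ∀ v, v ∈ h.roots.toFinset ↔ h.eval v = 0 := fun v => by
    rw [Multiset.mem_toFinset, mem_roots h0]; rfl
  obtain ⟨c, H, hH, -⟩ := partial_fractions h0 hs hg
  obtain ⟨u, hu, hu'⟩ := h2
  have hwv : ∀ v ∈ h.roots.toFinset, 0 < (w - v) ^ 2 := by
    intro v hv
    have : w - v ≠ 0 := by
      intro h3; rw [sub_eq_zero] at h3; rw [h3] at hne; exact hne ((hmem v).1 hv)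
    positivity
  have hdiv : ∀ v ∈ h.roots.toFinset, g.eval v / (derivative h).eval v =
      (g.eval v * (derivative h).eval v) / ((derivative h).eval v) ^ 2 := by
    intro v hv
    have := (hH v hv).2
    field_simp
  have s1 : 0 < ∑ v ∈ h.roots.toFinset, g.eval v / (derivative h).eval v / (w - v) ^ 2 := by
    refine Finset.sum_pos' (fun v hv => ?_) ⟨u, (hmem u).2 hu, ?_⟩
    · rw [hdiv v hv]
      exact div_nonneg (div_nonneg (h1 v ((hmem v).1 hv)) (sq_nonneg _)) (hwv v hv).le
    · rw [hdiv u ((hmem u).2 hu)]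
      have := (hH u ((hmem u).2 hu)).2
      exact div_pos (div_pos hu' (by positivity)) (hwv u ((hmem u).2 hu))
  have s2 : 0 < ∑ v ∈ h.roots.toFinset,
      (derivative h).eval v / (derivative h).eval v / (w - v) ^ 2 := by
    refine Finset.sum_pos (fun v hv => ?_) ⟨u, (hmem u).2 hu⟩
    rw [div_self (hH v hv).2]
    exact div_pos one_pos (hwv v hv)
  rw [e1, e2]
  have := mul_pos s1 s2
  have h3 : 0 < (h.eval w) ^ 2 := by positivity
  calc 0 < _ := mul_pos h3 this
    _ = _ := by ring

/-- Rolle: having as many distinct real zeros as the degree passes to the derivative. -/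
theorem card_roots_toFinset_derivative {h : ℝ[X]}
    (hs : h.roots.toFinset.card = h.natDegree) (hd : 0 < h.natDegree) :
    (derivative h).roots.toFinset.card = (derivative h).natDegree := by
  refine le_antisymm ((Multiset.toFinset_card_le _).trans (card_roots' _)) ?_
  have h1 := card_roots_toFinset_le_derivative h
  have h2 := natDegree_derivative_le h
  omega

/-- Iterating Markov's principle over all derivatives. -/
theorem markov_iterate {h g : ℝ[X]} (h0 : h ≠ 0)
    (hs : h.roots.toFinset.card = h.natDegree) (hg : g.natDegree ≤ h.natDegree)
    (h1 : ∀ v, h.eval v = 0 → 0 ≤ g.eval v * (derivative h).eval v)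
    (h2 : ∃ v, h.eval v = 0 ∧ 0 < g.eval v * (derivative h).eval v) (k : ℕ)
    (hk : k < h.natDegree) {w : ℝ} (hw : (derivative^[k + 1] h).eval w = 0) :
    0 < (derivative^[k + 1] g).eval w * (derivative^[k + 2] h).eval w := by
  induction k generalizing h g with
  | zero => exact markov_derivative h0 hs hg h1 h2 hw
  | succ k ih =>
    have hd : (derivative h).natDegree = h.natDegree - 1 := natDegree_derivative _
    have hs' := card_roots_toFinset_derivative hs (by omega)
    have h0' : derivative h ≠ 0 := by
      rintro h3; rw [h3] at hd; simp at hd; omega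
    -- One step turns the weak inequality into a strict one at every zero, so the hypotheses
    -- reproduce themselves.
    have hpos : ∀ v, (derivative h).eval v = 0 →
        0 < (derivative g).eval v * (derivative (derivative h)).eval v :=
      fun v hv => markov_derivative h0 hs hg h1 h2 hv
    have hex : (derivative h).roots.toFinset.Nonempty := by
      rw [← Finset.card_pos]; omega
    obtain ⟨v, hv⟩ := hex
    rw [Multiset.mem_toFinset, mem_roots h0'] at hv
    exact ih h0' hs' ((natDegree_derivative_le g).trans (by omega))
      (fun v hv => (hpos v hv).le) ⟨v, hv, hpos v hv⟩ (by omega) hw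

/-! ### Coefficients of ∂_z^k Ĝ_n and their signs. -/

/-- Expanding at z replaces each factor by X + (z + a) with z + a > 0. The inequality for all k
covers the coefficient beyond the degree that appears in the induction. -/
theorem taylor_prod_linear_coeff_pos (s : Multiset ℝ) {z : ℝ} (hs : ∀ a ∈ s, 0 < z + a) :
    (∀ k, 0 ≤ (taylor z (s.map fun a => X + C a).prod).coeff k) ∧
      ∀ k ≤ s.card, 0 < (taylor z (s.map fun a => X + C a).prod).coeff k := by
  induction s using Multiset.induction_on with
  | empty =>
    simp only [Multiset.map_zero, Multiset.prod_zero, taylor_one, map_one, Multiset.card_zero, coeff_one]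
    constructor
    · intro k; split_ifs <;> norm_num
    · intro k hk; simp [Nat.le_zero.1 hk]
  | cons a s ih =>
    obtain ⟨ih1, ih2⟩ := ih fun b hb => hs b (Multiset.mem_cons_of_mem hb)
    have ha := hs a (Multiset.mem_cons_self a s)
    have e : taylor z ((a ::ₘ s).map fun a => X + C a).prod =
        X * taylor z (s.map fun a => X + C a).prod +
          C (z + a) * taylor z (s.map fun a => X + C a).prod := by
      rw [Multiset.map_cons, Multiset.prod_cons, taylor_mul, map_add, taylor_X, taylor_C, C_add]
      ring
    rw [e]
    simp only [coeff_add, coeff_C_mul, Multiset.card_cons]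
    constructor
    · intro k
      cases k with
      | zero => simpa using mul_nonneg ha.le (ih1 0)
      | succ k =>
        rw [coeff_X_mul]
        exact add_nonneg (ih1 k) (mul_nonneg ha.le (ih1 _))
    · intro k hk
      cases k with
      | zero => simpa using mul_pos ha (ih2 0 (Nat.zero_le _))
      | succ k =>
        rw [coeff_X_mul]
        exact add_pos_of_pos_of_nonneg (ih2 k (by omega)) (mul_nonneg ha.le (ih1 _))

theorem iterate_derivative_prod_linear_pos (s : Multiset ℝ) {z : ℝ} (hs : ∀ a ∈ s, 0 < z + a)
    {k : ℕ} (hk : k ≤ s.card) :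
    0 < (derivative^[k] (s.map fun a => X + C a).prod).eval z := by
  rw [← factorial_smul_hasseDeriv]
  have := (taylor_prod_linear_coeff_pos s hs).2 k hk
  rw [taylor_coeff] at this
  rw [LinearMap.smul_apply, eval_smul, nsmul_eq_mul]
  exact mul_pos (by positivity) this

/-- The coefficient of `x^(n-2j)` in `Ĝ_n(x,z)`, up to a constant, as a polynomial in `z`. -/
def gegenbauerHatCoeff (n j : ℕ) : ℝ[X] :=
  (∏ i ∈ Finset.Ico (n - n / 2) (n - j), (X + C (i : ℝ))) *
    ∏ i ∈ Finset.Ico (n / 2) n, (X + C (1 / 2 + (i : ℝ)))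

/-- The constant factor of the coefficient of `x^(n-2j)` in `Ĝ_n(x,z)`. -/
def gegenbauerHatConst (n j : ℕ) : ℝ :=
  (-1) ^ j / ((j.factorial : ℝ) * ((n - 2 * j).factorial : ℝ) * 2 ^ (2 * j))

theorem gegenbauerHat_eq (n : ℕ) : gegenbauerHat n = ∑ j ∈ Finset.range (n / 2 + 1),
    C (C (gegenbauerHatConst n j) * X ^ (n - 2 * j)) * (gegenbauerHatCoeff n j).map C := by
  refine Finset.sum_congr rfl fun j _ => ?_
  simp [gegenbauerHatCoeff, gegenbauerHatConst, Polynomial.map_prod, Polynomial.map_mul]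

theorem gegenbauerHatDeriv_eq (n k : ℕ) (z : ℝ) :
    gegenbauerHatDeriv n k z = ∑ j ∈ Finset.range (n / 2 + 1),
      C (gegenbauerHatConst n j * (derivative^[k] (gegenbauerHatCoeff n j)).eval z) *
        X ^ (n - 2 * j) := by
  rw [gegenbauerHatDeriv, gegenbauerHat_eq, iterate_derivative_sum, eval_finsetSum]
  refine Finset.sum_congr rfl fun j _ => ?_
  rw [iterate_derivative_C_mul, eval_mul, eval_C, iterate_derivative_map, eval_map_apply, C_mul]
  ring

/-- `z ↦ Ĝ_n(x,z)` as a polynomial in `z`. -/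
def gegenbauerHatAt (n : ℕ) (x : ℝ) : ℝ[X] := ∑ j ∈ Finset.range (n / 2 + 1),
  C (gegenbauerHatConst n j * x ^ (n - 2 * j)) * gegenbauerHatCoeff n j

/-- `z ↦ ∂_x Ĝ_n(x,z)` as a polynomial in `z`. -/
def gegenbauerHatAtDx (n : ℕ) (x : ℝ) : ℝ[X] := ∑ j ∈ Finset.range (n / 2 + 1),
  C (gegenbauerHatConst n j * ((n - 2 * j : ℕ) * x ^ (n - 2 * j - 1))) * gegenbauerHatCoeff n j

theorem eval_gegenbauerHatDeriv (n k : ℕ) (z x : ℝ) :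
    (gegenbauerHatDeriv n k z).eval x = (derivative^[k] (gegenbauerHatAt n x)).eval z := by
  rw [gegenbauerHatDeriv_eq, gegenbauerHatAt, iterate_derivative_sum, eval_finsetSum,
    eval_finsetSum]
  refine Finset.sum_congr rfl fun j _ => ?_
  rw [iterate_derivative_C_mul]; simp; ring

theorem eval_derivative_gegenbauerHatDeriv (n k : ℕ) (z x : ℝ) :
    (derivative (gegenbauerHatDeriv n k z)).eval x =
      (derivative^[k] (gegenbauerHatAtDx n x)).eval z := by
  rw [gegenbauerHatDeriv_eq, gegenbauerHatAtDx, iterate_derivative_sum, derivative_sum,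
    eval_finsetSum, eval_finsetSum]
  refine Finset.sum_congr rfl fun j _ => ?_
  rw [iterate_derivative_C_mul, derivative_C_mul, derivative_X_pow]; simp; ring

theorem gegenbauerHatCoeff_natDegree_le {n j : ℕ} (hj : j ≤ n / 2) :
    (gegenbauerHatCoeff n j).natDegree ≤ n - j := by
  refine natDegree_mul_le.trans ?_
  rw [natDegree_prod_of_monic _ _ fun i _ => monic_X_add_C _,
    natDegree_prod_of_monic _ _ fun i _ => monic_X_add_C _]
  simp only [natDegree_X_add_C, Finset.sum_const, Nat.card_Ico, smul_eq_mul, mul_one]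
  omega

theorem iterate_derivative_gegenbauerHatCoeff_pos {n j k : ℕ} (hj : j ≤ n / 2) (hk : k ≤ n - j)
    {z : ℝ} (hz : -1 / 2 < z) : 0 < (derivative^[k] (gegenbauerHatCoeff n j)).eval z := by
  let s : Multiset ℝ := (Finset.Ico (n - n / 2) (n - j)).val.map (fun i : ℕ => (i : ℝ)) +
    (Finset.Ico (n / 2) n).val.map (fun i : ℕ => 1 / 2 + (i : ℝ))
  have hs : gegenbauerHatCoeff n j = (s.map fun a => X + C a).prod := by
    simp only [s, Multiset.map_add, Multiset.map_map, Multiset.prod_add]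
    rfl
  rw [hs]
  apply iterate_derivative_prod_linear_pos
  · intro a ha
    rcases Multiset.mem_add.1 ha with h | h
    · obtain ⟨i, hi, rfl⟩ := Multiset.mem_map.1 h
      -- The index range is empty for n = 0 and otherwise starts at n - ⌊n/2⌋ ≥ 1. The shifts of the
      -- second product start no lower than 1/2, matching z > -1/2.
      have hi' : 1 ≤ i := by
        have := Finset.mem_Ico.1 (Finset.mem_def.2 hi); omega
      have : (1 : ℝ) ≤ i := by exact_mod_cast hi'
      linarith
    · obtain ⟨i, hi, rfl⟩ := Multiset.mem_map.1 h
      have : (0 : ℝ) ≤ i := by positivity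
      linarith
  · simp [s]; omega

theorem iterate_derivative_gegenbauerHatCoeff_eq_zero {n j k : ℕ} (hj : j ≤ n / 2) (hk : n - j < k) :
    derivative^[k] (gegenbauerHatCoeff n j) = 0 :=
  iterate_derivative_eq_zero ((gegenbauerHatCoeff_natDegree_le hj).trans_lt hk)

theorem gegenbauerHatAt_natDegree_le (n : ℕ) (x : ℝ) : (gegenbauerHatAt n x).natDegree ≤ n :=
  natDegree_sum_le_of_forall_le _ _ fun j hj => (natDegree_C_mul_le _ _).trans
    ((gegenbauerHatCoeff_natDegree_le (by have := Finset.mem_range.1 hj; omega)).trans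
      (Nat.sub_le _ _))

theorem gegenbauerHatAtDx_natDegree_le (n : ℕ) (x : ℝ) : (gegenbauerHatAtDx n x).natDegree ≤ n :=
  natDegree_sum_le_of_forall_le _ _ fun j hj => (natDegree_C_mul_le _ _).trans
    ((gegenbauerHatCoeff_natDegree_le (by have := Finset.mem_range.1 hj; omega)).trans
      (Nat.sub_le _ _))

theorem posRootCount_eq (n k : ℕ) : posRootCount n k = min (n / 2) (n - k) := by
  unfold posRootCount; split_ifs <;> omega

/-- `∂_z^k Ĝ_n` is a polynomial with alternating coefficients. -/
theorem gegenbauerHatDeriv_shape {n k : ℕ} (hk : k ≤ n) {z : ℝ} (hz : -1 / 2 < z) :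
    ∃ a : ℕ → ℝ, (∀ j ≤ posRootCount n k, 0 < a j) ∧
      gegenbauerHatDeriv n k z = ∑ j ∈ Finset.range (posRootCount n k + 1),
        C ((-1) ^ j * a j) * X ^ (n - 2 * j) := by
  rw [posRootCount_eq]
  refine ⟨fun j => (derivative^[k] (gegenbauerHatCoeff n j)).eval z /
    ((j.factorial : ℝ) * ((n - 2 * j).factorial : ℝ) * 2 ^ (2 * j)), fun j hj => ?_, ?_⟩
  · exact div_pos (iterate_derivative_gegenbauerHatCoeff_pos (by omega) (by omega) hz)
      (by positivity)
  · rw [gegenbauerHatDeriv_eq]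
    symm
    -- The coefficient with index j has degree at most n - j in z, so its k-th derivative vanishes
    -- for j > n - k.
    have hsub : Finset.range (min (n / 2) (n - k) + 1) ⊆ Finset.range (n / 2 + 1) := by
      intro j hj; rw [Finset.mem_range] at *; omega
    rw [← Finset.sum_subset hsub]
    · refine Finset.sum_congr rfl fun j _ => ?_
      rw [gegenbauerHatConst]; congr 2; ring
    · intro j hj hj'
      rw [Finset.mem_range] at hj hj'
      rw [iterate_derivative_gegenbauerHatCoeff_eq_zero (by omega) (by omega)]; simp

/-! ### The hypergeometric form of Ĝ_n. -/

theorem two_mul_add_factorial (e l : ℕ) (he : e < 2) :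
    ((2 * l + e).factorial : ℝ) =
      l.factorial * 4 ^ l * (ascPochhammer ℝ l).eval (1 / 2 + (e : ℝ)) := by
  induction l with
  | zero => interval_cases e <;> simp
  | succ l ih =>
    rw [ascPochhammer_succ_eval, show 2 * (l + 1) + e = 2 * l + e + 1 + 1 by ring,
      Nat.factorial_succ, Nat.factorial_succ, Nat.factorial_succ]
    push_cast
    rw [ih]
    interval_cases e <;> push_cast <;> ring

theorem prod_Ico_add_eq_ascPochhammer (z : ℝ) (N l : ℕ) :
    ∏ i ∈ Finset.Ico N (N + l), (z + i) = (ascPochhammer ℝ l).eval (z + N) := by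
  induction l with
  | zero => simp
  | succ l ih =>
    rw [← add_assoc, Finset.prod_Ico_succ_top (by omega), ih, ascPochhammer_succ_eval]
    push_cast; ring

/-- The `z`-dependent factor of `Ĝ_n(x,z)` whose zeros do not depend on `x`. -/
def halfProd (n : ℕ) : ℝ[X] := ∏ i ∈ Finset.Ico (n / 2) n, (X + C (1 / 2 + (i : ℝ)))

/-- The constant factor relating `Ĝ_n` to the hypergeometric sum. -/
def hatConst (n : ℕ) : ℝ := (-1) ^ (n / 2) / ((n / 2).factorial * 4 ^ (n / 2))

/-- Summing in the reverse order l = ⌊n/2⌋ - j turns the product over z + i into a rising factorial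
of z + n - ⌊n/2⌋, and the duplication formula turns (n-2j)! = (2l+e)! into one of 1/2 + e. -/
theorem gegenbauerHatAt_eq (n : ℕ) (x : ℝ) :
    gegenbauerHatAt n x = C (hatConst n * x ^ (n % 2)) * halfProd n *
      (hyperB (n / 2) (1 / 2 + (n % 2 : ℕ)) (x ^ 2)).comp (X + C ((n - n / 2 : ℕ) : ℝ)) := by
  unfold hatConst halfProd
  refine Polynomial.funext fun z => ?_
  rw [gegenbauerHatAt, ← Finset.sum_range_reflect, eval_finsetSum]
  simp only [hyperB, eval_mul, eval_C, eval_comp, eval_add, eval_X, eval_finsetSum]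
  rw [Finset.mul_sum]
  refine Finset.sum_congr rfl fun l hl => ?_
  have hl' : l ≤ n / 2 := by have := Finset.mem_range.1 hl; omega
  simp only [gegenbauerHatCoeff, gegenbauerHatConst, eval_mul]
  have e1 : n / 2 + 1 - 1 - l = n / 2 - l := by omega
  have e2 : n - 2 * (n / 2 - l) = 2 * l + n % 2 := by omega
  have e3 : n - (n / 2 - l) = n - n / 2 + l := by omega
  rw [e1, e2, e3, two_mul_add_factorial _ _ (Nat.mod_lt _ two_pos)]
  have e4 : (∏ i ∈ Finset.Ico (n - n / 2) (n - n / 2 + l), (X + C (i : ℝ))).eval z =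
      (ascPochhammer ℝ l).eval (z + (n - n / 2 : ℕ)) := by
    rw [eval_prod, ← prod_Ico_add_eq_ascPochhammer]; simp
  rw [e4, pow_add x, ← pow_mul x]
  have hpos := ascPochhammer_eval_pos (c := 1 / 2 + (n % 2 : ℕ)) (by positivity) l
  generalize (ascPochhammer ℝ l).eval (1 / 2 + ((n % 2 : ℕ) : ℝ)) = A at *
  generalize hm : n / 2 = m at *
  obtain ⟨q, rfl⟩ := Nat.exists_eq_add_of_le hl'
  have hch : ((l + q).choose l : ℝ) = (l + q).factorial / (l.factorial * q.factorial) := by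
    rw [Nat.cast_add_choose]
  rw [hch, Nat.add_sub_cancel_left, pow_mul (2 : ℝ) 2, pow_add (-1 : ℝ), pow_add (4 : ℝ)]
  have h1 : ((-1 : ℝ) ^ l) ^ 2 = 1 := by rw [← pow_mul, mul_comm, pow_mul]; simp
  have h2 := (Nat.factorial_pos l).ne'
  have h3 := (Nat.factorial_pos q).ne'
  have h4 := (Nat.factorial_pos (l + q)).ne'
  generalize (∏ i ∈ Finset.Ico (l + q) n, (X + C (1 / 2 + (i : ℝ)))).eval z = B
  generalize (ascPochhammer ℝ l).eval (z + ((n - (l + q) : ℕ) : ℝ)) = D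
  norm_num
  field_simp
  linear_combination -(x ^ (l * 2) * x ^ (n % 2) * D * B) * h1

theorem hatConst_ne_zero (n : ℕ) : hatConst n ≠ 0 := by
  unfold hatConst
  exact div_ne_zero (pow_ne_zero _ (by norm_num)) (by positivity)

theorem gegenbauerHatDeriv_zero_eq (n : ℕ) (z : ℝ) :
    gegenbauerHatDeriv n 0 z = C (hatConst n * (halfProd n).eval z) * X ^ (n % 2) *
      (hyperT (n / 2) (1 / 2 + (n % 2 : ℕ)) (z + (n - n / 2 : ℕ))).comp (X ^ 2) := by
  refine Polynomial.funext fun x => ?_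
  rw [eval_gegenbauerHatDeriv, Function.iterate_zero_apply, gegenbauerHatAt_eq]
  simp only [eval_mul, eval_C, eval_comp, eval_add, eval_X, eval_hyperB, eval_pow]
  ring

theorem halfProd_eval_pos (n : ℕ) {z : ℝ} (hz : -1 / 2 < z) : 0 < (halfProd n).eval z := by
  rw [halfProd, eval_prod]
  refine Finset.prod_pos fun i _ => ?_
  have : (0 : ℝ) ≤ i := by positivity
  simp only [eval_add, eval_X, eval_C]
  linarith

theorem half_add_cast_sub (n : ℕ) :
    ((n - n / 2 : ℕ) : ℝ) = (n / 2 : ℕ) + (n % 2 : ℕ) := by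
  have : n - n / 2 = n / 2 + n % 2 := by omega
  rw [this]; push_cast; ring

/-- For c = 1/2 + e and b = z + m + e, where m = ⌊n/2⌋ and e = n mod 2, the condition c + m < b + 1
of `hyperT_roots` is exactly z > -1/2. Square roots of the zeros in t = x², in reversed order, give
the zeros in x. -/
theorem gegenbauerHatDeriv_zero_roots (n : ℕ) {z : ℝ} (hz : -1 / 2 < z) :
    ∃ r : ℕ → ℝ, (∀ i j, i < j → j < n / 2 → r j < r i) ∧
      ∀ i < n / 2, 0 < r i ∧ r i < 1 ∧ (gegenbauerHatDeriv n 0 z).eval (r i) = 0 := by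
  obtain ⟨t, ht, ht'⟩ := hyperT_roots (n / 2) (c := 1 / 2 + (n % 2 : ℕ))
    (b := z + (n - n / 2 : ℕ)) (by positivity) (by rw [half_add_cast_sub]; linarith)
  refine ⟨fun i => √(t (n / 2 - 1 - i)), fun i j hij hj => ?_, fun i hi => ?_⟩
  · exact Real.sqrt_lt_sqrt (ht' _ (by omega)).1.le (ht _ _ (by omega) (by omega))
  · obtain ⟨h1, h2, h3⟩ := ht' (n / 2 - 1 - i) (by omega)
    refine ⟨Real.sqrt_pos.2 h1, (Real.sqrt_lt' one_pos).2 (by simpa using h2), ?_⟩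
    rw [gegenbauerHatDeriv_zero_eq]
    rw [eval_mul, eval_comp, eval_pow, eval_X, Real.sq_sqrt h1.le, h3, mul_zero]

/-! ### Zeros in z for fixed x, and transversality. -/

/-- Separates the two families of zeros: those of the Meixner factor, shifted to the variable z,
exceed 1/2 - ⌊n/2⌋. -/
theorem halfProd_eval_eq_zero {n : ℕ} {v : ℝ} (h : (halfProd n).eval v = 0) :
    v ≤ -(1 / 2) - (n / 2 : ℕ) := by
  rw [halfProd, eval_prod, Finset.prod_eq_zero_iff] at h
  obtain ⟨i, hi, h⟩ := h
  have : ((n / 2 : ℕ) : ℝ) ≤ i := by exact_mod_cast (Finset.mem_Ico.1 hi).1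
  simp only [eval_add, eval_X, eval_C] at h
  linarith

theorem eval_gegenbauerHatAt (n : ℕ) (x v : ℝ) : (gegenbauerHatAt n x).eval v =
    hatConst n * x ^ (n % 2) * (halfProd n).eval v *
      (hyperT (n / 2) (1 / 2 + (n % 2 : ℕ)) (v + (n - n / 2 : ℕ))).eval (x ^ 2) := by
  rw [gegenbauerHatAt_eq]
  simp only [eval_mul, eval_C, eval_comp, eval_add, eval_X, eval_hyperB]

/-- At a root of `v ↦ Ĝ_n(x,v)` the derivatives in `x` and in `v` do not have opposite signs. -/
theorem gegenbauerHatAt_transversal (n : ℕ) {x v : ℝ} (hx : 0 < x) (hx1 : x < 1)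
    (hv : (gegenbauerHatAt n x).eval v = 0) :
    0 ≤ (gegenbauerHatAtDx n x).eval v * (derivative (gegenbauerHatAt n x)).eval v ∧
    ((halfProd n).eval v ≠ 0 →
      0 < (gegenbauerHatAtDx n x).eval v * (derivative (gegenbauerHatAt n x)).eval v) := by
  have hg : (gegenbauerHatAtDx n x).eval v = (derivative (gegenbauerHatDeriv n 0 v)).eval x :=
    (eval_derivative_gegenbauerHatDeriv n 0 v x).symm
  -- At a zero of `halfProd`, Ĝ_n vanishes identically in x; such zeros do not move, and only the
  -- weak inequality holds.
  by_cases hB : (halfProd n).eval v = 0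
  · refine ⟨?_, fun h => absurd hB h⟩
    rw [hg, gegenbauerHatDeriv_zero_eq, hB]; simp
  suffices h : 0 < (gegenbauerHatAtDx n x).eval v * (derivative (gegenbauerHatAt n x)).eval v from
    ⟨h.le, fun _ => h⟩
  have hK := hatConst_ne_zero n
  have hT : (hyperT (n / 2) (1 / 2 + (n % 2 : ℕ)) (v + (n - n / 2 : ℕ))).eval (x ^ 2) = 0 := by
    rw [eval_gegenbauerHatAt] at hv
    have : hatConst n * x ^ (n % 2) * (halfProd n).eval v ≠ 0 :=
      mul_ne_zero (mul_ne_zero hK (pow_ne_zero _ hx.ne')) hB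
    exact (mul_eq_zero.1 hv).resolve_left this
  have hpos := hyper_derivative_mul_pos (n / 2) (c := 1 / 2 + (n % 2 : ℕ)) (by positivity)
    (t := x ^ 2) (by positivity) (by nlinarith) hT
  have e1 : (gegenbauerHatAtDx n x).eval v = hatConst n * x ^ (n % 2) * (halfProd n).eval v *
      (2 * x) * (derivative (hyperT (n / 2) (1 / 2 + (n % 2 : ℕ))
        (v + (n - n / 2 : ℕ)))).eval (x ^ 2) := by
    rw [hg, gegenbauerHatDeriv_zero_eq, derivative_mul, eval_add, eval_mul, eval_mul, eval_comp,
      eval_pow, eval_X, hT, derivative_comp]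
    simp [eval_comp]
    ring
  have e2 : (derivative (gegenbauerHatAt n x)).eval v = hatConst n * x ^ (n % 2) *
      (halfProd n).eval v * (derivative (hyperB (n / 2) (1 / 2 + (n % 2 : ℕ)) (x ^ 2))).eval
        (v + (n - n / 2 : ℕ)) := by
    rw [gegenbauerHatAt_eq, derivative_mul, eval_add, eval_mul, eval_mul, eval_comp,
      eval_add, eval_X, eval_C, eval_hyperB, hT, derivative_comp]
    simp [eval_comp]
  rw [e1, e2]
  have : 0 < (hatConst n * x ^ (n % 2) * (halfProd n).eval v) ^ 2 * (2 * x) := by positivity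
  calc 0 < _ := mul_pos this hpos
    _ = _ := by ring

theorem gegenbauerHatDeriv_self_eval_pos (n : ℕ) {x z : ℝ} (hx : 0 < x) (hz : -1 / 2 < z) :
    0 < (gegenbauerHatDeriv n n z).eval x := by
  obtain ⟨a, ha, h⟩ := gegenbauerHatDeriv_shape le_rfl hz (n := n)
  have h0 : posRootCount n n = 0 := by rw [posRootCount_eq]; simp
  rw [h0] at h ha
  rw [h]
  simp
  exact mul_pos (ha 0 le_rfl) (by positivity)

theorem gegenbauerHatAt_ne_zero (n : ℕ) {x : ℝ} (hx : 0 < x) : gegenbauerHatAt n x ≠ 0 := by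
  intro h
  have := gegenbauerHatDeriv_self_eval_pos n hx (z := 0) (by norm_num)
  rw [eval_gegenbauerHatDeriv, h] at this
  simp at this

/-- Supplies the one zero with strict inequality that Markov's principle requires; for n ≥ 2 the
Meixner factor has positive degree. -/
theorem gegenbauerHatAt_root (n : ℕ) (hn : 2 ≤ n) {x : ℝ} (hx : 0 < x) (hx1 : x < 1) :
    ∃ v, (gegenbauerHatAt n x).eval v = 0 ∧ (halfProd n).eval v ≠ 0 := by
  obtain ⟨r, -, hr⟩ := hyperB_roots (n / 2) (c := 1 / 2 + (n % 2 : ℕ)) (t := x ^ 2)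
    (by positivity) (by positivity) (by nlinarith)
  obtain ⟨h1, h2⟩ := hr 0 (by omega)
  refine ⟨r 0 - (n - n / 2 : ℕ), ?_, fun h => ?_⟩
  · rw [eval_gegenbauerHatAt, ← eval_hyperB, sub_add_cancel, h2, mul_zero]
  · have h3 := halfProd_eval_eq_zero h
    rw [half_add_cast_sub] at h3
    linarith

/-- For `0 < x < 1`, the polynomial `v ↦ Ĝ_n(x,v)` has `n` distinct real roots. -/
theorem card_roots_gegenbauerHatAt (n : ℕ) {x : ℝ} (hx : 0 < x) (hx1 : x < 1) :
    (gegenbauerHatAt n x).roots.toFinset.card = n ∧ (gegenbauerHatAt n x).natDegree = n := by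
  obtain ⟨r, hr1, hr⟩ := hyperB_roots (n / 2) (c := 1 / 2 + (n % 2 : ℕ)) (t := x ^ 2)
    (by positivity) (by positivity) (by nlinarith)
  have h0 := gegenbauerHatAt_ne_zero n hx
  -- `A` holds the zeros of the Meixner factor, `B` those of `halfProd`; together they exhaust the
  -- degree.
  let A := (Finset.range (n / 2)).image fun i => r i - (n - n / 2 : ℕ)
  let B := (Finset.Ico (n / 2) n).image fun i : ℕ => -(1 / 2 : ℝ) - i
  have hA : A.card = n / 2 := by
    rw [Finset.card_image_of_injOn, Finset.card_range]
    intro i hi j hj hij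
    simp only [Finset.coe_range, Set.mem_Iio, sub_left_inj] at hi hj hij
    rcases lt_trichotomy i j with h | h | h
    · exact absurd hij (hr1 i j h hj).ne
    · exact h
    · exact absurd hij.symm (hr1 j i h hi).ne
  have hB : B.card = n - n / 2 := by
    rw [Finset.card_image_of_injective, Nat.card_Ico]
    intro i j hij
    simpa using hij
  have hdisj : Disjoint A B := by
    rw [Finset.disjoint_left]
    intro v hv hv'
    obtain ⟨i, hi, rfl⟩ := Finset.mem_image.1 hv
    obtain ⟨j, hj, hij⟩ := Finset.mem_image.1 hv'
    have h1 := (hr i (Finset.mem_range.1 hi)).1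
    have h2 : ((n / 2 : ℕ) : ℝ) ≤ j := by exact_mod_cast (Finset.mem_Ico.1 hj).1
    rw [half_add_cast_sub] at hij
    linarith
  have hsub : A ∪ B ⊆ (gegenbauerHatAt n x).roots.toFinset := by
    intro v hv
    rw [Multiset.mem_toFinset, mem_roots h0, IsRoot.def, eval_gegenbauerHatAt]
    rcases Finset.mem_union.1 hv with h | h
    · obtain ⟨i, hi, rfl⟩ := Finset.mem_image.1 h
      rw [← eval_hyperB, sub_add_cancel, (hr i (Finset.mem_range.1 hi)).2, mul_zero]
    · obtain ⟨i, hi, rfl⟩ := Finset.mem_image.1 h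
      have : (halfProd n).eval (-(1 / 2 : ℝ) - i) = 0 := by
        rw [halfProd, eval_prod]
        refine Finset.prod_eq_zero hi ?_
        simp only [eval_add, eval_X, eval_C]; ring
      rw [this]; simp
  have h1 := Finset.card_le_card hsub
  rw [Finset.card_union_of_disjoint hdisj, hA, hB] at h1
  have h2 := (Multiset.toFinset_card_le (gegenbauerHatAt n x).roots).trans (card_roots' _)
  have h3 := gegenbauerHatAt_natDegree_le n x
  omega

/-- At a root `x` of `∂_z^k Ĝ_n(·,z)` in `(0,1)`, the derivatives in `x` and `z` have the same
sign. -/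
theorem gegenbauerHatDeriv_transversal {n k : ℕ} (hn : 2 ≤ n) (hk : k ≤ n) {x z : ℝ} (hx : 0 < x)
    (hx1 : x < 1) (hz : -1 / 2 < z) (h : (gegenbauerHatDeriv n k z).eval x = 0) :
    0 < (derivative (gegenbauerHatDeriv n k z)).eval x *
      (gegenbauerHatDeriv n (k + 1) z).eval x := by
  have hkn : k ≠ n := by
    rintro rfl
    exact (gegenbauerHatDeriv_self_eval_pos k hx hz).ne' h
  rw [eval_derivative_gegenbauerHatDeriv, eval_gegenbauerHatDeriv]
  rw [eval_gegenbauerHatDeriv] at h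
  cases k with
  | zero =>
    exact (gegenbauerHatAt_transversal n hx hx1 h).2 (halfProd_eval_pos n hz).ne'
  | succ k =>
    obtain ⟨h1, h2⟩ := card_roots_gegenbauerHatAt n hx hx1
    obtain ⟨v, hv, hv'⟩ := gegenbauerHatAt_root n hn hx hx1
    exact markov_iterate (gegenbauerHatAt_ne_zero n hx) (h1.trans h2.symm)
      ((gegenbauerHatAtDx_natDegree_le n x).trans h2.ge)
      (fun v hv => (gegenbauerHatAt_transversal n hx hx1 hv).1)
      ⟨v, hv, (gegenbauerHatAt_transversal n hx hx1 hv).2 hv'⟩ k (by omega) h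

/-! ### Polynomials of fixed parity with alternating coefficients. -/

/-- The known zeros, their opposites and the zero at 0 already number d + d + (n - 2d) = n, so the
degree bound leaves no room for others or for higher multiplicities. -/
theorem roots_eq_of_symmetric {F : ℝ[X]} {n d : ℕ} (hd : 2 * d ≤ n) (hF0 : F ≠ 0)
    (hdeg : F.natDegree ≤ n) (hX : X ^ (n - 2 * d) ∣ F)
    (hpar : ∀ x, F.eval (-x) = (-1) ^ n * F.eval x) {r : ℕ → ℝ}
    (hr : ∀ i j, i < j → j < d → r j < r i) (hpos : ∀ i < d, 0 < r i)
    (hroot : ∀ i < d, F.eval (r i) = 0) :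
    F.roots = (Multiset.range d).map r + (Multiset.range d).map (fun i => -r i) +
      Multiset.replicate (n - 2 * d) 0 := by
  have hinj : ∀ i < d, ∀ j < d, r i = r j → i = j := by
    intro i hi j hj hij
    rcases lt_trichotomy i j with h | h | h
    · exact absurd hij (hr i j h hj).ne'
    · exact h
    · exact absurd hij (hr j i h hi).ne
  have hn1 : ((Multiset.range d).map r + (Multiset.range d).map (fun i => -r i)).Nodup := by
    refine Multiset.nodup_add.2 ⟨?_, ?_, ?_⟩
    · exact Multiset.Nodup.map_on (fun i hi j hj => hinj i (Multiset.mem_range.1 hi) j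
        (Multiset.mem_range.1 hj)) (Multiset.nodup_range d)
    · exact Multiset.Nodup.map_on (fun i hi j hj h => hinj i (Multiset.mem_range.1 hi) j
        (Multiset.mem_range.1 hj) (neg_injective h)) (Multiset.nodup_range d)
    · rw [Multiset.disjoint_left]
      intro a h1 h2
      obtain ⟨i, hi, rfl⟩ := Multiset.mem_map.1 h1
      obtain ⟨j, hj, h⟩ := Multiset.mem_map.1 h2
      have := hpos i (Multiset.mem_range.1 hi)
      have := hpos j (Multiset.mem_range.1 hj)
      linarith
  have hmem : ∀ a ∈ (Multiset.range d).map r + (Multiset.range d).map (fun i => -r i),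
      a ≠ 0 ∧ F.eval a = 0 := by
    intro a ha
    rcases Multiset.mem_add.1 ha with h | h
    · obtain ⟨i, hi, rfl⟩ := Multiset.mem_map.1 h
      exact ⟨(hpos i (Multiset.mem_range.1 hi)).ne', hroot i (Multiset.mem_range.1 hi)⟩
    · obtain ⟨i, hi, rfl⟩ := Multiset.mem_map.1 h
      have := (hpos i (Multiset.mem_range.1 hi)).ne'
      exact ⟨neg_ne_zero.2 this, by rw [hpar, hroot i (Multiset.mem_range.1 hi), mul_zero]⟩
  symm
  refine Multiset.eq_of_le_of_card_le ?_ ?_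
  · rw [Multiset.le_iff_count]
    intro a
    rw [Multiset.count_add, Multiset.count_replicate, count_roots]
    by_cases ha : a ∈ (Multiset.range d).map r + (Multiset.range d).map (fun i => -r i)
    · obtain ⟨h1, h2⟩ := hmem a ha
      rw [Multiset.count_eq_one_of_mem hn1 ha, if_neg (Ne.symm h1)]
      exact (rootMultiplicity_pos hF0).2 h2
    · rw [Multiset.count_eq_zero_of_notMem ha, zero_add]
      split_ifs with h
      · subst h
        rw [le_rootMultiplicity_iff hF0]; simpa using hX
      · exact Nat.zero_le _
  · refine (card_roots' F).trans (hdeg.trans ?_)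
    simp; omega

theorem sort_map_range {d : ℕ} {r : ℕ → ℝ} (hr : ∀ i j, i < j → j < d → r j < r i) :
    ((Multiset.range d).map r).sort (fun a b => b ≤ a) = (List.range d).map r := by
  rw [Multiset.range, Multiset.map_coe, Multiset.coe_sort]
  refine List.mergeSort_eq_self (r := fun a b : ℝ => b ≤ a) ?_
  rw [List.pairwise_map]
  refine List.Pairwise.imp_of_mem ?_ (List.pairwise_lt_range (n := d))
  intro i j _ hj hij
  exact (hr i j hij (List.mem_range.1 hj)).le

theorem posRoots_eq_of_symmetric {F : ℝ[X]} {n d : ℕ} {r : ℕ → ℝ}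
    (hroots : F.roots = (Multiset.range d).map r + (Multiset.range d).map (fun i => -r i) +
      Multiset.replicate (n - 2 * d) 0)
    (hr : ∀ i j, i < j → j < d → r j < r i) (hpos : ∀ i < d, 0 < r i) :
    posRoots F = (List.range d).map r ∧
      negRoots F = (((List.range d).map r).map (fun y => -y)).reverse := by
  constructor
  · rw [posRoots, hroots, Multiset.filter_add, Multiset.filter_add, Multiset.filter_eq_self.2,
      Multiset.filter_eq_nil.2, Multiset.filter_eq_nil.2, add_zero, add_zero, sort_map_range hr]
    · intro a ha; rw [Multiset.eq_of_mem_replicate ha]; simp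
    · intro a ha
      obtain ⟨i, hi, rfl⟩ := Multiset.mem_map.1 ha
      have := hpos i (Multiset.mem_range.1 hi); linarith
    · intro a ha
      obtain ⟨i, hi, rfl⟩ := Multiset.mem_map.1 ha
      exact hpos i (Multiset.mem_range.1 hi)
  · rw [negRoots, hroots, Multiset.filter_add, Multiset.filter_add, Multiset.filter_eq_nil.2,
      Multiset.filter_eq_self.2, Multiset.filter_eq_nil.2, add_zero, zero_add]
    · have e : (Multiset.range d).map (fun i => -r i) =
          ((((List.range d).map r).map (fun y => -y)).reverse : List ℝ) := by
        rw [Multiset.coe_reverse, List.map_map, Multiset.range, Multiset.map_coe]; rfl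
      rw [e, Multiset.coe_sort]
      refine List.mergeSort_eq_self (r := fun a b : ℝ => b ≤ a) ?_
      rw [List.pairwise_reverse, List.pairwise_map, List.pairwise_map]
      refine List.Pairwise.imp_of_mem ?_ (List.pairwise_lt_range (n := d))
      intro i j _ hj hij
      exact neg_le_neg (hr i j hij (List.mem_range.1 hj)).le
    · intro a ha; rw [Multiset.eq_of_mem_replicate ha]; simp
    · intro a ha
      obtain ⟨i, hi, rfl⟩ := Multiset.mem_map.1 ha
      have := hpos i (Multiset.mem_range.1 hi); linarith
    · intro a ha
      obtain ⟨i, hi, rfl⟩ := Multiset.mem_map.1 ha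
      have := hpos i (Multiset.mem_range.1 hi); linarith

theorem derivative_sign_of_symmetric {F : ℝ[X]} {n d : ℕ} {r : ℕ → ℝ} (hF : F.Splits)
    (hlead : 0 < F.leadingCoeff)
    (hroots : F.roots = (Multiset.range d).map r + (Multiset.range d).map (fun i => -r i) +
      Multiset.replicate (n - 2 * d) 0)
    (hr : ∀ i j, i < j → j < d → r j < r i) (hpos : ∀ i < d, 0 < r i) {i : ℕ} (hi : i < d) :
    0 < (-1) ^ i * (derivative F).eval (r i) := by
  have h1 := C_leadingCoeff_mul_prod_multiset_X_sub_C (splits_iff_card_roots.1 hF)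
  rw [hroots, Multiset.map_add, Multiset.map_add, Multiset.prod_add, Multiset.prod_add,
    Multiset.map_map, Multiset.map_map, Multiset.map_replicate, Multiset.prod_replicate] at h1
  have h2 : F = (∏ j ∈ Finset.range d, (X - C (r j))) *
      (C F.leadingCoeff * (∏ j ∈ Finset.range d, (X - C (-r j))) * (X - C 0) ^ (n - 2 * d)) := by
    conv_lhs => rw [← h1]
    simp only [Finset.prod, Finset.range_val, Function.comp_def]
    ring
  have hri := hpos i hi
  rw [h2, eval_derivative_prod_mul r _ hi, ← mul_assoc]
  refine mul_pos ?_ ?_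
  · exact prod_erase_sign hi (fun j hj => sub_neg.2 (hr j i hj hi))
      (fun j h1 h2 => sub_pos.2 (hr i j h1 h2))
  · simp only [eval_mul, eval_C, eval_prod, eval_sub, eval_X, eval_pow, sub_zero, sub_neg_eq_add]
    refine mul_pos (mul_pos hlead (Finset.prod_pos fun j hj => ?_)) (by positivity)
    have := hpos j (Finset.mem_range.1 hj); linarith

section Alternating

variable {F : ℝ[X]} {n d : ℕ} {a : ℕ → ℝ}

theorem natDegree_le_of_alternating
    (h : F = ∑ j ∈ Finset.range (d + 1), C ((-1) ^ j * a j) * X ^ (n - 2 * j)) :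
    F.natDegree ≤ n := by
  rw [h]
  refine natDegree_sum_le_of_forall_le _ _ fun j _ => ?_
  exact (natDegree_C_mul_X_pow_le _ _).trans (Nat.sub_le _ _)

theorem coeff_of_alternating (hd : 2 * d ≤ n)
    (h : F = ∑ j ∈ Finset.range (d + 1), C ((-1) ^ j * a j) * X ^ (n - 2 * j)) :
    F.coeff n = a 0 := by
  rw [h, finsetSum_coeff, Finset.sum_eq_single 0]
  · simp
  · intro j hj hj0
    rw [coeff_C_mul_X_pow, if_neg]
    have := Finset.mem_range.1 hj; omega
  · simp

theorem factor_of_alternating (hd : 2 * d ≤ n)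
    (h : F = ∑ j ∈ Finset.range (d + 1), C ((-1) ^ j * a j) * X ^ (n - 2 * j)) :
    F = X ^ (n - 2 * d) *
      ∑ j ∈ Finset.range (d + 1), C ((-1) ^ j * a j) * X ^ (2 * (d - j)) := by
  rw [h, Finset.mul_sum]
  refine Finset.sum_congr rfl fun j hj => ?_
  have := Finset.mem_range.1 hj
  rw [show n - 2 * j = n - 2 * d + 2 * (d - j) by omega, pow_add]; ring

theorem eval_neg_of_alternating (hd : 2 * d ≤ n)
    (h : F = ∑ j ∈ Finset.range (d + 1), C ((-1) ^ j * a j) * X ^ (n - 2 * j)) (x : ℝ) :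
    F.eval (-x) = (-1) ^ n * F.eval x := by
  rw [h, eval_finsetSum, eval_finsetSum, Finset.mul_sum]
  refine Finset.sum_congr rfl fun j hj => ?_
  have := Finset.mem_range.1 hj
  obtain ⟨q, rfl⟩ : ∃ q, n = q + 2 * j := ⟨n - 2 * j, by omega⟩
  simp only [eval_mul, eval_C, eval_pow, eval_X, Nat.add_sub_cancel]
  rw [neg_pow x, pow_add (-1 : ℝ) q, pow_mul (-1 : ℝ) 2]
  norm_num
  ring

/-- Near 0+ the lowest term (-1)^d a_d x^(n-2d) dominates. -/
theorem eventually_sign_of_alternating (hd : 2 * d ≤ n) (ha : 0 < a d)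
    (h : F = ∑ j ∈ Finset.range (d + 1), C ((-1) ^ j * a j) * X ^ (n - 2 * j)) :
    ∀ᶠ x in nhdsWithin (0 : ℝ) (Set.Ioi 0), 0 < (-1) ^ d * F.eval x := by
  set K : ℝ[X] := ∑ j ∈ Finset.range (d + 1), C ((-1) ^ j * a j) * X ^ (2 * (d - j)) with hK
  have hFK := factor_of_alternating hd h
  have hK0 : (-1) ^ d * K.eval 0 = a d := by
    rw [hK, eval_finsetSum, Finset.sum_eq_single d]
    · have : ((-1 : ℝ) ^ d) * (-1) ^ d = 1 := by rw [← mul_pow]; simp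
      simp [← mul_assoc, this]
    · intro j hj hjd
      have := Finset.mem_range.1 hj
      simp [show 2 * (d - j) ≠ 0 by omega]
    · simp
  have hc : ContinuousAt (fun x => (-1) ^ d * K.eval x) 0 :=
    (continuous_const.mul K.continuous).continuousAt
  have h1 : ∀ᶠ x in nhds (0 : ℝ), 0 < (-1) ^ d * K.eval x :=
    hc.eventually (lt_mem_nhds (by simpa only [hK0] using ha))
  filter_upwards [h1.filter_mono nhdsWithin_le_nhds, self_mem_nhdsWithin] with x hx hx0
  rw [hFK, eval_mul, eval_pow, eval_X]
  have : 0 < x ^ (n - 2 * d) := pow_pos hx0 _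
  calc 0 < _ := mul_pos this hx
    _ = _ := by ring

end Alternating

/-! ### Induction on k: zeros in (0,1) and interlacing. -/

/-- `r 0 > r 1 > ⋯` lists `posRootCount n k` roots of `∂_z^k Ĝ_n(·,z)` in `(0,1)`. -/
def IsRootSeq (n k : ℕ) (z : ℝ) (r : ℕ → ℝ) : Prop :=
  (∀ i j, i < j → j < posRootCount n k → r j < r i) ∧
    ∀ i < posRootCount n k, 0 < r i ∧ r i < 1 ∧ (gegenbauerHatDeriv n k z).eval (r i) = 0

theorem two_mul_posRootCount_le (n k : ℕ) : 2 * posRootCount n k ≤ n := by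
  rw [posRootCount_eq]; omega

theorem gegenbauerHatDeriv_degree {n k : ℕ} (hk : k ≤ n) {z : ℝ} (hz : -1 / 2 < z) :
    gegenbauerHatDeriv n k z ≠ 0 ∧ (gegenbauerHatDeriv n k z).natDegree = n ∧
      0 < (gegenbauerHatDeriv n k z).leadingCoeff := by
  obtain ⟨a, ha, h⟩ := gegenbauerHatDeriv_shape hk hz
  have hc := coeff_of_alternating (two_mul_posRootCount_le n k) h
  have ha0 := ha 0 (Nat.zero_le _)
  have hdeg : (gegenbauerHatDeriv n k z).natDegree = n :=
    le_antisymm (natDegree_le_of_alternating h)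
      (le_natDegree_of_ne_zero (by rw [hc]; exact ha0.ne'))
  refine ⟨?_, hdeg, by rw [leadingCoeff, hdeg, hc]; exact ha0⟩
  rintro h0
  rw [h0] at hc; simp at hc; exact ha0.ne hc

theorem IsRootSeq.roots_eq {n k : ℕ} (hk : k ≤ n) {z : ℝ} (hz : -1 / 2 < z) {r : ℕ → ℝ}
    (h : IsRootSeq n k z r) :
    (gegenbauerHatDeriv n k z).roots = (Multiset.range (posRootCount n k)).map r +
      (Multiset.range (posRootCount n k)).map (fun i => -r i) +
      Multiset.replicate (n - 2 * posRootCount n k) 0 := by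
  obtain ⟨a, ha, hs⟩ := gegenbauerHatDeriv_shape hk hz
  obtain ⟨h0, hdeg, -⟩ := gegenbauerHatDeriv_degree hk hz
  have hd := two_mul_posRootCount_le n k
  exact roots_eq_of_symmetric hd h0 hdeg.le ⟨_, factor_of_alternating hd hs⟩
    (eval_neg_of_alternating hd hs) h.1 (fun i hi => (h.2 i hi).1) (fun i hi => (h.2 i hi).2.2)

theorem IsRootSeq.splits {n k : ℕ} (hk : k ≤ n) {z : ℝ} (hz : -1 / 2 < z) {r : ℕ → ℝ}
    (h : IsRootSeq n k z r) : (gegenbauerHatDeriv n k z).Splits := by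
  rw [splits_iff_card_roots, h.roots_eq hk hz, (gegenbauerHatDeriv_degree hk hz).2.1]
  have := two_mul_posRootCount_le n k
  simp; omega

theorem IsRootSeq.rootMultiplicity_zero {n k : ℕ} (hk : k ≤ n) {z : ℝ} (hz : -1 / 2 < z)
    {r : ℕ → ℝ} (h : IsRootSeq n k z r) :
    (gegenbauerHatDeriv n k z).rootMultiplicity 0 = n - 2 * posRootCount n k := by
  rw [← count_roots, h.roots_eq hk hz, Multiset.count_add, Multiset.count_add,
    Multiset.count_replicate_self, Multiset.count_eq_zero_of_notMem,
    Multiset.count_eq_zero_of_notMem, zero_add, zero_add]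
  · intro h0
    obtain ⟨i, hi, h0⟩ := Multiset.mem_map.1 h0
    exact (h.2 i (Multiset.mem_range.1 hi)).1.ne' (neg_eq_zero.1 h0)
  · intro h0
    obtain ⟨i, hi, h0⟩ := Multiset.mem_map.1 h0
    exact (h.2 i (Multiset.mem_range.1 hi)).1.ne' h0

theorem IsRootSeq.posRoots_eq {n k : ℕ} (hk : k ≤ n) {z : ℝ} (hz : -1 / 2 < z) {r : ℕ → ℝ}
    (h : IsRootSeq n k z r) :
    posRoots (gegenbauerHatDeriv n k z) = (List.range (posRootCount n k)).map r ∧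
    negRoots (gegenbauerHatDeriv n k z) =
      (((List.range (posRootCount n k)).map r).map (fun y => -y)).reverse :=
  posRoots_eq_of_symmetric (h.roots_eq hk hz) h.1 fun i hi => (h.2 i hi).1

/-- The roots of `∂_z^{k+1} Ĝ_n` interlace those of `∂_z^k Ĝ_n`. -/
theorem IsRootSeq.exists_succ {n k : ℕ} (hk : k + 1 ≤ n) {z : ℝ} (hz : -1 / 2 < z) {r : ℕ → ℝ}
    (h : IsRootSeq n k z r) : ∃ s, IsRootSeq n (k + 1) z s ∧
      (∀ i < posRootCount n (k + 1), s i < r i) ∧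
      ∀ i, i + 1 < posRootCount n k → r (i + 1) < s i := by
  set d := posRootCount n k with hd
  set d' := posRootCount n (k + 1) with hd'
  have hdd : d' = d ∨ d' + 1 = d := by rw [hd, hd', posRootCount_eq, posRootCount_eq]; omega
  obtain ⟨-, -, hlead⟩ := gegenbauerHatDeriv_degree (by omega : k ≤ n) hz
  -- Transversality transfers the alternating signs of the x-derivative to the next z-derivative.
  have hsign : ∀ i < d, 0 < (-1) ^ i * (gegenbauerHatDeriv n (k + 1) z).eval (r i) := by
    intro i hi
    have hn : 2 ≤ n := by have := two_mul_posRootCount_le n k; omega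
    obtain ⟨h0, h1, h2⟩ := h.2 i hi
    have ht := gegenbauerHatDeriv_transversal hn (by omega) h0 h1 hz h2
    have hs := derivative_sign_of_symmetric (h.splits (by omega) hz) hlead
      (h.roots_eq (by omega) hz) h.1 (fun i hi => (h.2 i hi).1) hi
    rcases neg_one_pow_eq_or ℝ i with h | h <;> rw [h] at hs ⊢ <;> nlinarith
  obtain ⟨η, hη0, hηr, hη⟩ : ∃ η : ℝ, 0 < η ∧ (∀ i ∈ Finset.range d, η < r i) ∧
      0 < (-1) ^ d' * (gegenbauerHatDeriv n (k + 1) z).eval η := by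
    obtain ⟨a, ha, hs⟩ := gegenbauerHatDeriv_shape hk hz
    have h1 := eventually_sign_of_alternating (two_mul_posRootCount_le n (k + 1)) (ha _ le_rfl) hs
    have h2 : ∀ᶠ η in nhdsWithin (0 : ℝ) (Set.Ioi 0), ∀ i ∈ Finset.range d, η < r i := by
      rw [Filter.eventually_all_finset]
      intro i hi
      exact (gt_mem_nhds (h.2 i (Finset.mem_range.1 hi)).1).filter_mono nhdsWithin_le_nhds
    obtain ⟨η, h3, h4, h5⟩ := (eventually_mem_nhdsWithin.and (h2.and h1)).exists
    exact ⟨η, h3, h4, h5⟩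
  have hex : ∀ i, ∃ s, i < d' → 0 < s ∧ s < r i ∧ (i + 1 < d → r (i + 1) < s) ∧
      (gegenbauerHatDeriv n (k + 1) z).eval s = 0 := by
    intro i
    by_cases hi : i < d'
    · have hs1 := hsign i (by omega)
      by_cases hi' : i + 1 < d
      · obtain ⟨s, h1, h2, h3⟩ := exists_root_Ioo_of_mul_neg _ (h.1 i (i + 1) (by omega) hi')
          ((mul_comm _ _).trans_lt (mul_neg_of_alternating hs1 (hsign (i + 1) hi')))
        exact ⟨s, fun _ => ⟨(h.2 _ hi').1.trans h1, h2, fun _ => h1, h3⟩⟩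
      -- This case occurs only for d' = d: the smallest new zero lies between `η` and the smallest
      -- old one.
      · rw [show d' = i + 1 by omega] at hη
        obtain ⟨s, h1, h2, h3⟩ := exists_root_Ioo_of_mul_neg _
          (hηr i (Finset.mem_range.2 (by omega)))
          ((mul_comm _ _).trans_lt (mul_neg_of_alternating hs1 hη))
        exact ⟨s, fun _ => ⟨hη0.trans h1, h2, fun h => absurd h hi', h3⟩⟩
    · exact ⟨0, fun h => absurd h hi⟩
  choose s hs using hex
  refine ⟨s, ⟨fun i j hij hj => ?_, fun i hi => ?_⟩, fun i hi => (hs i hi).2.1,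
    fun i hi => (hs i (by omega)).2.2.1 hi⟩
  · have hj' : j < d' := hj
    have h1 := (hs i (by omega)).2.2.1 (by omega)
    refine (hs j hj).2.1.trans_le (le_trans ?_ h1.le)
    rcases (show i + 1 ≤ j by omega).eq_or_lt with h2 | h2
    · rw [h2]
    · exact (h.1 _ _ h2 (by omega)).le
  · have hi' : i < d' := hi
    obtain ⟨h1, h2, -, h3⟩ := hs i hi
    exact ⟨h1, h2.trans (h.2 i (by omega)).2.1, h3⟩

theorem exists_isRootSeq {n k : ℕ} (hk : k ≤ n) {z : ℝ} (hz : -1 / 2 < z) :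
    ∃ r, IsRootSeq n k z r := by
  induction k with
  | zero =>
    have h0 : posRootCount n 0 = n / 2 := by rw [posRootCount_eq]; omega
    obtain ⟨r, h1, h2⟩ := gegenbauerHatDeriv_zero_roots n hz
    exact ⟨r, by rw [h0]; exact h1, by rw [h0]; exact h2⟩
  | succ k ih =>
    obtain ⟨r, hr⟩ := ih (by omega)
    obtain ⟨s, hs, -⟩ := hr.exists_succ hk hz
    exact ⟨s, hs⟩

theorem getD_map_range {d i : ℕ} (r : ℕ → ℝ) (hi : i < d) :
    ((List.range d).map r).getD i 0 = r i := by
  rw [List.getD_eq_getElem _ _ (by simpa using hi)]; simp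

theorem getD_reverse_neg_map_range {d i : ℕ} (r : ℕ → ℝ) (hi : i < d) :
    ((((List.range d).map r).map (fun y => -y)).reverse).getD i 0 = -r (d - 1 - i) := by
  rw [List.getD_eq_getElem _ _ (by simpa using hi)]; simp

theorem strictlyInterlace_map_range {d d' : ℕ} {r s : ℕ → ℝ} (hd : d' = d ∨ d' + 1 = d)
    (h1 : ∀ i < d', s i < r i) (h2 : ∀ i, i + 1 < d → r (i + 1) < s i) :
    StrictlyInterlace ((List.range d).map r) ((List.range d').map s) := by
  refine Or.inl ⟨by simpa using hd, fun i hi => ?_, fun i hi => ?_⟩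
  · simp only [List.length_map, List.length_range] at hi
    rw [getD_map_range _ hi, getD_map_range _ (by omega)]
    exact h1 i hi
  · simp only [List.length_map, List.length_range] at hi
    rw [getD_map_range _ hi, getD_map_range _ (by omega)]
    exact h2 i hi

theorem strictlyInterlace_reverse_neg {d d' : ℕ} {r s : ℕ → ℝ} (hd : d' = d ∨ d' + 1 = d)
    (h1 : ∀ i < d', s i < r i) (h2 : ∀ i, i + 1 < d → r (i + 1) < s i) :
    StrictlyInterlace (((List.range d).map r).map (fun y => -y)).reverse
      (((List.range d').map s).map (fun y => -y)).reverse := by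
  -- Negation reverses the order: for equal lengths the roles of the two lists are exchanged,
  -- otherwise they are kept.
  rcases hd with rfl | rfl
  · refine Or.inr ⟨by simp, by simp, fun i hi => ?_, fun i hi => ?_⟩
    · simp only [List.length_reverse, List.length_map, List.length_range] at hi
      rw [getD_reverse_neg_map_range _ hi, getD_reverse_neg_map_range _ hi]
      exact neg_lt_neg (h1 _ (by omega))
    · simp only [List.length_reverse, List.length_map, List.length_range] at hi
      rw [getD_reverse_neg_map_range _ hi, getD_reverse_neg_map_range _ (by omega)]
      have := h2 (d' - 1 - (i + 1)) (by omega)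
      rw [show d' - 1 - (i + 1) + 1 = d' - 1 - i by omega] at this
      exact neg_lt_neg this
  · refine Or.inl ⟨by simp, fun i hi => ?_, fun i hi => ?_⟩
    · simp only [List.length_reverse, List.length_map, List.length_range] at hi
      rw [getD_reverse_neg_map_range _ hi, getD_reverse_neg_map_range _ (by omega)]
      have := h2 (d' - 1 - i) (by omega)
      rw [show d' - 1 - i + 1 = d' + 1 - 1 - i by omega] at this
      exact neg_lt_neg this
    · simp only [List.length_reverse, List.length_map, List.length_range] at hi
      rw [getD_reverse_neg_map_range _ hi, getD_reverse_neg_map_range _ (by omega)]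
      have := h1 (d' - 1 - i) (by omega)
      rw [show d' + 1 - 1 - (i + 1) = d' - 1 - i by omega]
      exact neg_lt_neg this

/-! ### Motion of the zeros in z. -/

/-- The implicit function theorem for the zero set of a bivariate function. -/
theorem exists_implicit_hasDerivAt {f : ℝ × ℝ → ℝ} (hf : ContDiff ℝ 1 f) {z x a b : ℝ}
    (h0 : f (z, x) = 0) (ha : HasDerivAt (fun w => f (w, x)) a z)
    (hb : HasDerivAt (fun y => f (z, y)) b x) (hb0 : b ≠ 0) :
    ∃ φ : ℝ → ℝ, φ z = x ∧ HasDerivAt φ (-a / b) z ∧ ∀ᶠ w in nhds z, f (w, φ w) = 0 := by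
  have hst : HasStrictFDerivAt f (fderiv ℝ f (z, x)) (z, x) :=
    hf.contDiffAt.hasStrictFDerivAt one_ne_zero
  set L := fderiv ℝ f (z, x)
  have hLa : L (1, 0) = a := by
    have h1 : HasDerivAt (fun w : ℝ => (w, x)) ((1 : ℝ), (0 : ℝ)) z :=
      (hasDerivAt_id z).prodMk (hasDerivAt_const z x)
    exact (hst.hasFDerivAt.comp_hasDerivAt z h1).unique ha
  have hLb : L (0, 1) = b := by
    have h1 : HasDerivAt (fun y : ℝ => (z, y)) ((0 : ℝ), (1 : ℝ)) x :=
      (hasDerivAt_const x z).prodMk (hasDerivAt_id x)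
    exact (hst.hasFDerivAt.comp_hasDerivAt x h1).unique hb
  have hinv : (L ∘L .inr ℝ ℝ ℝ).IsInvertible := by
    refine ⟨ContinuousLinearEquiv.unitsEquivAut ℝ (Units.mk0 b hb0), ?_⟩
    ext
    simp [hLb]
  let φ := hst.implicitFunctionOfProdDomain hinv
  have hφ0 : φ z = x :=
    eq_of_tendsto_nhds (hst.tendsto_implicitFunctionOfProdDomain hinv)
  have hev : ∀ᶠ w in nhds z, f (w, φ w) = 0 := by
    have := hst.eventually_apply_implicitFunctionOfProdDomain hinv
    rwa [h0] at this
  have hdiff : HasDerivAt φ (deriv φ z) z :=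
    (hst.hasStrictFDerivAt_implicitFunctionOfProdDomain hinv).hasFDerivAt.differentiableAt.hasDerivAt
  refine ⟨φ, hφ0, ?_, hev⟩
  have h1 : HasDerivAt (fun w : ℝ => (w, φ w)) ((1 : ℝ), deriv φ z) z :=
    (hasDerivAt_id z).prodMk hdiff
  have h2 : HasDerivAt (fun w => f (w, φ w)) (L (1, deriv φ z)) z := by
    have hst' : HasFDerivAt f L (z, φ z) := by rw [hφ0]; exact hst.hasFDerivAt
    exact hst'.comp_hasDerivAt z h1
  have h3 : L (1, deriv φ z) = 0 :=
    h2.unique ((hasDerivAt_const z (0 : ℝ)).congr_of_eventuallyEq hev)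
  have h4 : L (1, deriv φ z) = a + deriv φ z * b := by
    have : ((1 : ℝ), deriv φ z) = (1, 0) + deriv φ z • (0, 1) := by simp
    rw [this, map_add, map_smul, hLa, hLb, smul_eq_mul]
  have h5 : deriv φ z = -a / b := by
    rw [eq_div_iff hb0]; linarith
  rwa [h5] at hdiff

theorem contDiff_eval_gegenbauerHatDeriv (n k : ℕ) :
    ContDiff ℝ 1 fun p : ℝ × ℝ => (gegenbauerHatDeriv n k p.1).eval p.2 := by
  simp only [gegenbauerHatDeriv_eq, eval_finsetSum, eval_mul, eval_C, eval_pow, eval_X]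
  refine ContDiff.sum fun j _ => ?_
  have h : ContDiff ℝ 1 fun p : ℝ × ℝ => (derivative^[k] (gegenbauerHatCoeff n j)).eval p.1 :=
    ((derivative^[k] (gegenbauerHatCoeff n j)).contDiff_aeval (𝕜 := ℝ) 1).comp contDiff_fst
  exact (contDiff_const.mul h).mul (contDiff_snd.pow _)

theorem hasDerivAt_eval_gegenbauerHatDeriv (n k : ℕ) (x z : ℝ) :
    HasDerivAt (fun w => (gegenbauerHatDeriv n k w).eval x)
      ((gegenbauerHatDeriv n (k + 1) z).eval x) z := by
  simp only [eval_gegenbauerHatDeriv, Function.iterate_succ_apply']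
  exact Polynomial.hasDerivAt _ z

/-- The positive roots of `∂_z^k Ĝ_n(·,z)` are differentiable in `z`, with negative derivative. -/
theorem hasDerivAt_posRoots {n k : ℕ} (hk : k ≤ n) {i : ℕ} (hi : i < posRootCount n k) {z : ℝ}
    (hz : -1 / 2 < z) : ∃ e : ℝ, e < 0 ∧
      HasDerivAt (fun w => (posRoots (gegenbauerHatDeriv n k w)).getD i 0) e z := by
  obtain ⟨r, hr⟩ := exists_isRootSeq hk hz
  have hn : 2 ≤ n := by have := two_mul_posRootCount_le n k; omega
  -- Branches through all positive zeros are needed, since the place of one zero in the sorted list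
  -- depends on the others.
  have hex : ∀ j, ∃ φ : ℝ → ℝ, j < posRootCount n k → φ z = r j ∧
      (∃ e : ℝ, e < 0 ∧ HasDerivAt φ e z) ∧
      ∀ᶠ w in nhds z, (gegenbauerHatDeriv n k w).eval (φ w) = 0 := by
    intro j
    by_cases hj : j < posRootCount n k
    · obtain ⟨h0, h1, h2⟩ := hr.2 j hj
      have ht := gegenbauerHatDeriv_transversal hn hk h0 h1 hz h2
      have hb : (derivative (gegenbauerHatDeriv n k z)).eval (r j) ≠ 0 := left_ne_zero_of_mul ht.ne'
      obtain ⟨φ, h3, h4, h5⟩ := exists_implicit_hasDerivAt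
        (contDiff_eval_gegenbauerHatDeriv n k) h2
        (hasDerivAt_eval_gegenbauerHatDeriv n k (r j) z)
        ((gegenbauerHatDeriv n k z).hasDerivAt (r j)) hb
      refine ⟨φ, fun _ => ⟨h3, ⟨_, ?_, h4⟩, h5⟩⟩
      rw [neg_div]
      refine neg_neg_of_pos ?_
      -- Multiplying by the square of the x-derivative turns the quotient into the product known to
      -- be positive.
      rw [div_eq_mul_inv, ← mul_pos_iff_of_pos_right (sq_pos_of_ne_zero hb)]
      calc 0 < _ := ht
        _ = _ := by field_simp
    · exact ⟨0, fun h => absurd h hj⟩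
  choose φ hφ using hex
  have hcont : ∀ j < posRootCount n k, Filter.Tendsto (φ j) (nhds z) (nhds (r j)) := by
    intro j hj
    obtain ⟨h1, ⟨e, -, h2⟩, -⟩ := hφ j hj
    rw [← h1]; exact h2.continuousAt
  -- By continuity the branches stay ordered and inside (0,1); since the root count does not depend
  -- on w, they form the entire sorted list near z.
  have hseq : ∀ᶠ w in nhds z, IsRootSeq n k w (fun j => φ j w) := by
    have h1 : ∀ᶠ w in nhds z, ∀ j ∈ Finset.range (posRootCount n k), 0 < φ j w ∧ φ j w < 1 ∧
        (gegenbauerHatDeriv n k w).eval (φ j w) = 0 := by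
      rw [Filter.eventually_all_finset]
      intro j hj
      have hj' := Finset.mem_range.1 hj
      obtain ⟨h0, h1, -⟩ := hr.2 j hj'
      exact ((hcont j hj').eventually_const_lt h0).and
        (((hcont j hj').eventually_lt_const h1).and (hφ j hj').2.2)
    have h2 : ∀ᶠ w in nhds z, ∀ j ∈ Finset.range (posRootCount n k), ∀ l ∈ Finset.range j,
        φ j w < φ l w := by
      rw [Filter.eventually_all_finset]
      intro j hj
      rw [Filter.eventually_all_finset]
      intro l hl
      have hj' := Finset.mem_range.1 hj
      have hl' := Finset.mem_range.1 hl
      exact (hcont j hj').eventually_lt (hcont l (by omega)) (hr.1 l j hl' hj')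
    filter_upwards [h1, h2] with w h3 h4
    exact ⟨fun l j hl hj => h4 j (Finset.mem_range.2 hj) l (Finset.mem_range.2 hl),
      fun j hj => h3 j (Finset.mem_range.2 hj)⟩
  obtain ⟨-, ⟨e, he, h2⟩, -⟩ := hφ i hi
  refine ⟨e, he, h2.congr_of_eventuallyEq ?_⟩
  filter_upwards [hseq, lt_mem_nhds hz] with w hw hwz
  rw [(hw.posRoots_eq hk hwz).1, getD_map_range _ hi]

theorem negRoots_getD {n k : ℕ} (hk : k ≤ n) {i : ℕ} (hi : i < posRootCount n k) {z : ℝ}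
    (hz : -1 / 2 < z) : (negRoots (gegenbauerHatDeriv n k z)).getD i 0 =
      -(posRoots (gegenbauerHatDeriv n k z)).getD (posRootCount n k - 1 - i) 0 := by
  obtain ⟨r, hr⟩ := exists_isRootSeq hk hz
  obtain ⟨h1, h2⟩ := hr.posRoots_eq hk hz
  rw [h1, h2, getD_map_range _ (by omega), getD_reverse_neg_map_range _ hi]

theorem hasDerivAt_negRoots {n k : ℕ} (hk : k ≤ n) {i : ℕ} (hi : i < posRootCount n k) {z : ℝ}
    (hz : -1 / 2 < z) : ∃ e : ℝ, 0 < e ∧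
      HasDerivAt (fun w => (negRoots (gegenbauerHatDeriv n k w)).getD i 0) e z := by
  obtain ⟨e, he, h⟩ := hasDerivAt_posRoots hk
    (show posRootCount n k - 1 - i < posRootCount n k by omega) hz
  refine ⟨-e, by linarith, h.neg.congr_of_eventuallyEq ?_⟩
  filter_upwards [lt_mem_nhds hz] with w hw
  exact negRoots_getD hk hi hw

end

theorem mainTheorem6 (n : ℕ) :
    -- for every `z > -1/2` and `k ≤ n`
    (∀ z : ℝ, -1 / 2 < z → ∀ k : ℕ, k ≤ n →
      -- real-rooted in `x`, of degree `n`
      (gegenbauerHatDeriv n k z).Splits ∧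
      (gegenbauerHatDeriv n k z).degree = (n : WithBot ℕ) ∧
      -- number of positive roots (all of them simple); the negative roots are symmetric
      (posRoots (gegenbauerHatDeriv n k z)).length = posRootCount n k ∧
      (posRoots (gegenbauerHatDeriv n k z)).Nodup ∧
      negRoots (gegenbauerHatDeriv n k z) =
        ((posRoots (gegenbauerHatDeriv n k z)).map (fun y => -y)).reverse ∧
      -- zero roots add two by two
      (n - n / 2 ≤ k → k + 1 ≤ n →
        (gegenbauerHatDeriv n (k + 1) z).rootMultiplicity 0 =
          (gegenbauerHatDeriv n k z).rootMultiplicity 0 + 2) ∧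
      -- strict interlacing of the positive roots, and of the negative roots
      (k + 1 ≤ n →
        StrictlyInterlace (posRoots (gegenbauerHatDeriv n k z))
          (posRoots (gegenbauerHatDeriv n (k + 1) z)) ∧
        StrictlyInterlace (negRoots (gegenbauerHatDeriv n k z))
          (negRoots (gegenbauerHatDeriv n (k + 1) z)))) ∧
    -- the `i`-th positive root decreases with `z`, the `i`-th negative root increases with `z`
    (∀ k : ℕ, k ≤ n → ∀ i : ℕ, i < posRootCount n k →
      StrictAntiOn (fun z => (posRoots (gegenbauerHatDeriv n k z)).getD i 0) (Set.Ioi (-1 / 2)) ∧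
      StrictMonoOn (fun z => (negRoots (gegenbauerHatDeriv n k z)).getD i 0) (Set.Ioi (-1 / 2)) ∧
      ∀ z : ℝ, -1 / 2 < z →
        (∃ d : ℝ, d < 0 ∧
          HasDerivAt (fun w => (posRoots (gegenbauerHatDeriv n k w)).getD i 0) d z) ∧
        (∃ d : ℝ, 0 < d ∧
          HasDerivAt (fun w => (negRoots (gegenbauerHatDeriv n k w)).getD i 0) d z)) := by
  refine ⟨fun z hz k hk => ?_, fun k hk i hi => ⟨?_, ?_, fun z hz =>
    ⟨hasDerivAt_posRoots hk hi hz, hasDerivAt_negRoots hk hi hz⟩⟩⟩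
  · obtain ⟨r, hr⟩ := exists_isRootSeq hk hz
    obtain ⟨h0, hdeg, -⟩ := gegenbauerHatDeriv_degree hk hz
    obtain ⟨hpos, hneg⟩ := hr.posRoots_eq hk hz
    refine ⟨hr.splits hk hz, by rw [degree_eq_natDegree h0, hdeg], by simp [hpos], ?_,
      by rw [hpos, hneg], fun h1 h2 => ?_, fun h1 => ?_⟩
    · rw [hpos]
      refine List.Nodup.map_on (fun i hi j hj hij => ?_) List.nodup_range
      rcases lt_trichotomy i j with h | h | h
      · exact absurd hij (hr.1 i j h (List.mem_range.1 hj)).ne'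
      · exact h
      · exact absurd hij (hr.1 j i h (List.mem_range.1 hi)).ne
    · obtain ⟨s, hs⟩ := exists_isRootSeq h2 hz
      rw [hr.rootMultiplicity_zero hk hz, hs.rootMultiplicity_zero h2 hz, posRootCount_eq,
        posRootCount_eq]
      omega
    · obtain ⟨s, hs, hs1, hs2⟩ := hr.exists_succ h1 hz
      obtain ⟨hpos', hneg'⟩ := hs.posRoots_eq h1 hz
      have hd : posRootCount n (k + 1) = posRootCount n k ∨
          posRootCount n (k + 1) + 1 = posRootCount n k := by
        rw [posRootCount_eq, posRootCount_eq]; omega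
      rw [hpos, hneg, hpos', hneg']
      exact ⟨strictlyInterlace_map_range hd hs1 hs2, strictlyInterlace_reverse_neg hd hs1 hs2⟩
  · refine strictAntiOn_of_deriv_neg (convex_Ioi _) (fun z hz => ?_) fun z hz => ?_
    · obtain ⟨e, -, he⟩ := hasDerivAt_posRoots hk hi hz
      exact he.continuousAt.continuousWithinAt
    · rw [interior_Ioi] at hz
      obtain ⟨e, he0, he⟩ := hasDerivAt_posRoots hk hi hz
      rw [he.deriv]; exact he0
  · refine strictMonoOn_of_deriv_pos (convex_Ioi _) (fun z hz => ?_) fun z hz => ?_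
    · obtain ⟨e, -, he⟩ := hasDerivAt_negRoots hk hi hz
      exact he.continuousAt.continuousWithinAt
    · rw [interior_Ioi] at hz
      obtain ⟨e, he0, he⟩ := hasDerivAt_negRoots hk hi hz
      rw [he.deriv]; exact he0
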